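/- For an integer $n\ge 1$ let $A_n=\{H_I : \emptyset\ne I\subseteq\{1,\dots,n\}\}$ be the resonance arrangement in $\mathbb{R}^n$, where $H_I=\{x\in\mathbb{R}^n : \sum_{i\in I}x_i=0\}$. Its characteristic polynomial is $$\chi(A_n;t)=\sum_{S\subseteq A_n}(-1)^{|S|}\,t^{\,r(A_n)-r(S)},\qquad r(S)=\operatorname{codim}\bigcap_{H\in S}H,$$ and its $i$-th Betti number $b_i(A_n)$ is the absolute value of the coefficient of $t^{n-i}$ in $\chi(A_n;t)$ (so $b_i(A_n)=0$ for $i>n$). Let $S(m,k)$ denote the Stirling number of the second kind, the number of partitions of a set of $m$ elements into $k$ nonempty blocks. Then for every $n\ge 1$: (i) $\displaystyle b_2(A_n)=2S(n+1,3)+3S(n+1,4)=\tfrac12\left(4^n-3^n-2^n+1\right);$ (ii) $\displaystyle b_3(A_n)=9S(n+1,4)+80S(n+1,5)+345S(n+1,6)+840S(n+1,7)+840S(n+1,8)$ $\displaystyle\qquad =\tfrac1{4!}\left(4\cdot 8^n-15\cdot 6^n+15\cdot 5^n-14\cdot 4^n+18\cdot 3^n-7\cdot 2^n-1\right).$ 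-/

import Mathlib

noncomputable section

namespace ResonanceArrangement

open Polynomial

/-- The subspace `H_I = {x | ∑_{i ∈ I} x_i = 0}` of `ℝⁿ`
(a hyperplane as soon as `I` is nonempty). -/
def hyperplane {n : ℕ} (I : Finset (Fin n)) : Submodule ℝ (Fin n → ℝ) where
  carrier := {x | ∑ i ∈ I, x i = 0}
  zero_mem' := by simp
  add_mem' := by
    intro x y hx hy
    simp only [Set.mem_ofPred_eq] at hx hy ⊢
    simp [Finset.sum_add_distrib, hx, hy]
  smul_mem' := by
    intro c x hx
    simp only [Set.mem_ofPred_eq] at hx ⊢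
    simp [← Finset.mul_sum, hx]

open Classical in
/-- The resonance arrangement `A_n = {H_I | ∅ ≠ I ⊆ [n]}` in `ℝⁿ`. -/
def resonance (n : ℕ) : Finset (Submodule ℝ (Fin n → ℝ)) :=
  (Finset.univ.filter fun I : Finset (Fin n) => I.Nonempty).image hyperplane

/-- `r(S)`, the codimension in `Fⁿ` of the intersection of the members of a finite set `S` of
linear subspaces (the empty intersection is `Fⁿ`). -/
def rank {F : Type*} [Field F] {n : ℕ} (S : Finset (Submodule F (Fin n → F))) : ℕ :=
  Module.finrank F ((Fin n → F) ⧸ S.inf id)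

/-- The characteristic polynomial `χ(A; t) = ∑_{S ⊆ A} (-1)^{|S|} t^{r(A) - r(S)}` of an
arrangement of linear hyperplanes in `Fⁿ`. The subtraction does not truncate,
as `r(S) ≤ r(A)`. -/
def charPoly {F : Type*} [Field F] {n : ℕ} (A : Finset (Submodule F (Fin n → F))) : ℤ[X] :=
  ∑ S ∈ A.powerset, (-1) ^ S.card * X ^ (rank A - rank S)

/-- The `i`-th Betti number: the absolute value of the coefficient of `t^{n - i}` in `χ(A; t)`,
which is `0` for `i > n`, where the exponent `n - i` is negative. (The arrangement is understood
to be essential, that is of rank `n`, as the resonance arrangement is.) -/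
def betti {F : Type*} [Field F] {n : ℕ} (A : Finset (Submodule F (Fin n → F))) (i : ℕ) : ℕ :=
  if i ≤ n then ((charPoly A).coeff (n - i)).natAbs else 0

end ResonanceArrangement

end

/-!
By Whitney's broken circuit theorem (`sum_neg_one_pow_card_eq_card_isNBC`), the `k`-th Betti number
of an arrangement is the number of `k`-sets of hyperplanes without broken circuits, with respect to
any linear order. For the resonance arrangement `H_I` is identified with the nonempty set `I`, and
the order is one in which bigger sets come first: `I` comes before `J` if
`toColex J < toColex I`.

A pair `{a, b}` contains a broken circuit precisely if `a` and `b` are disjoint, since then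
`1_{a ∪ b} = 1_a + 1_b`, where `1_a` is the `0/1`-vector of `a`. So `b_2` counts the pairs of
distinct intersecting sets. Three distinct, pairwise intersecting sets contain a broken circuit in
exactly two kinds of situation (`isNBC_triple_iff`):

* every point of their union `u` lies in exactly two of them, and `1_a + 1_b + 1_c = 2 * 1_u`;
* an earlier set `e` satisfies `1_a + 1_b = 1_c + 1_e`, up to the order of `a`, `b`, `c`.

These exclude each other, and `e` and its place in the relation are determined by the triple. In the
second case `{a, b, c}` is a quadruple of distinct sets with `1_a + 1_b = 1_c + 1_e` and a common
point, less its first member. Hence, with ordered triples and quadruples,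
`24 * b_3 = 4 * T - 4 * R - 3 * Q`, where `T` counts the triples of distinct, pairwise intersecting
sets, `R` those of the first kind, and `Q` the quadruples: by symmetry each of its four members is
the first in `Q / 4` of them, and there are three choices of the member on the side of `e`.

All these numbers are computed in the same way. A tuple of subsets of `{1, …, n}` is a table with
`n` columns; a condition on the columns separately that allows `m` patterns is met by `m ^ n` tuples
(`tupleCount_of_columns`), and inclusion-exclusion does the rest.
-/

noncomputable section

namespace ResonanceArrangement

open Finset Polynomial

/-! ### Whitney's broken circuit theorem -/

section NBC

variable {F : Type*} [Field F] {V : Type*} [AddCommGroup V] [Module F V]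
  {ι L : Type*} [LinearOrder L]

/-- The codimension of the intersection of the kernels of the forms `φ i`, `i ∈ S`. -/
def codim (φ : ι → Module.Dual F V) (S : Finset ι) : ℕ :=
  Module.finrank F (V ⧸ S.inf fun i => LinearMap.ker (φ i))

/-- The element `e` is dependent on the members of `S` that come after it, where `s` comes after
`e` if `w s < w e`: the kernel of `φ e` contains the intersection of their kernels. Equivalently,
`e` is the first element of a circuit all of whose other elements lie in `S`. -/
def IsDependentOnLater (φ : ι → Module.Dual F V) (w : ι → L) (S : Finset ι) (e : ι) : Prop :=
  (S.filter fun s => w s < w e).inf (fun i => LinearMap.ker (φ i)) ≤ LinearMap.ker (φ e)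

/-- `S` contains no broken circuit of the arrangement of the kernels of `φ e`, `e ∈ E`. -/
def IsNBC (φ : ι → Module.Dual F V) (w : ι → L) (E S : Finset ι) : Prop :=
  ∀ e ∈ E, ¬ IsDependentOnLater φ w S e

variable {φ : ι → Module.Dual F V} {w : ι → L} {E S : Finset ι}

theorem isDependentOnLater_mono {S T : Finset ι} {e : ι} (h : S ⊆ T)
    (hS : IsDependentOnLater φ w S e) : IsDependentOnLater φ w T e :=
  (Finset.inf_mono (Finset.filter_subset_filter _ h)).trans hS

variable [DecidableEq ι]

theorem codim_insert_of_le {e : ι}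
    (h : (S.inf fun i => LinearMap.ker (φ i)) ≤ LinearMap.ker (φ e)) :
    codim φ (insert e S) = codim φ S := by
  rw [codim, Finset.inf_insert, inf_eq_right.mpr h, codim]

theorem codim_insert_of_not_le [FiniteDimensional F V] {e : ι}
    (h : ¬ (S.inf fun i => LinearMap.ker (φ i)) ≤ LinearMap.ker (φ e)) :
    codim φ (insert e S) = codim φ S + 1 := by
  have hφ : φ e ≠ 0 := by
    rintro h0
    exact h (by simp [h0])
  have hco : LinearMap.ker (φ e) ⊔ (S.inf fun i => LinearMap.ker (φ i)) = ⊤ := by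
    have : IsCoatom (LinearMap.ker (φ e)) :=
      LinearMap.isCoatom_ker_of_surjective (LinearMap.surjective hφ)
    exact this.2 _ (left_lt_sup.mpr h)
  have h1 := Submodule.finrank_sup_add_finrank_inf_eq (LinearMap.ker (φ e))
    (S.inf fun i => LinearMap.ker (φ i))
  rw [hco, finrank_top] at h1
  have h2 := Module.Dual.finrank_ker_add_one_of_ne_zero hφ
  have h3 := Submodule.finrank_quotient_add_finrank (S.inf fun i => LinearMap.ker (φ i))
  have h4 := Submodule.finrank_quotient_add_finrank
    (LinearMap.ker (φ e) ⊓ S.inf fun i => LinearMap.ker (φ i))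
  rw [codim, Finset.inf_insert, codim]
  omega

/-- Sets without broken circuits are independent: adding their elements one at a time, the last
one first, every step raises the codimension. -/
theorem codim_eq_card_of_isNBC [FiniteDimensional F V] (hw : Function.Injective w)
    (hSE : S ⊆ E) (hS : IsNBC φ w E S) : codim φ S = S.card := by
  induction hk : S.card generalizing S with
  | zero =>
    rw [Finset.card_eq_zero] at hk
    subst hk
    have := Submodule.finrank_quotient_add_finrank (⊤ : Submodule F V)
    rw [finrank_top] at this
    rw [codim, Finset.inf_empty]
    omega
  | succ k ih =>
    have hne : S.Nonempty := Finset.card_pos.mp (by omega)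
    obtain ⟨e, he, hmax⟩ := S.exists_max_image w hne
    have hfil : S.filter (fun s => w s < w e) = S.erase e := by
      ext s
      simp only [Finset.mem_filter, Finset.mem_erase]
      refine ⟨fun h => ⟨fun h' => by simp [h'] at h, h.1⟩, fun h => ⟨h.2, ?_⟩⟩
      exact lt_of_le_of_ne (hmax s h.2) fun h' => h.1 (hw h')
    have h1 := hS e (hSE he)
    rw [IsDependentOnLater, hfil] at h1
    have h2 := ih (S := S.erase e) ((Finset.erase_subset _ _).trans hSE)
      (fun x hx h => hS x hx (isDependentOnLater_mono (Finset.erase_subset _ _) h))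
      (by rw [Finset.card_erase_of_mem he, hk]; rfl)
    rw [← Finset.insert_erase he, codim_insert_of_not_le h1, h2]

/-- The symmetric difference of `S` and `{e}`. -/
def toggle (S : Finset ι) (e : ι) : Finset ι := if e ∈ S then S.erase e else insert e S

theorem toggle_toggle (S : Finset ι) (e : ι) : toggle (toggle S e) e = S := by
  by_cases h : e ∈ S <;> simp [toggle, h]

theorem toggle_ne (S : Finset ι) (e : ι) : toggle S e ≠ S := by
  by_cases h : e ∈ S
  · simp only [toggle, h, if_true]
    exact fun h' => Finset.notMem_erase e S (by rwa [h'])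
  · simp only [toggle, h, if_false]
    exact fun h' => h (by rw [← h']; exact Finset.mem_insert_self e S)

theorem neg_one_pow_card_toggle (S : Finset ι) (e : ι) :
    (-1 : ℤ) ^ S.card + (-1) ^ (toggle S e).card = 0 := by
  by_cases h : e ∈ S
  · simp only [toggle, h, if_true]
    rw [← Finset.card_erase_add_one h]
    ring
  · simp only [toggle, h, if_false]
    rw [Finset.card_insert_of_notMem h]
    ring

theorem toggle_subset (hS : S ⊆ E) {e : ι} (he : e ∈ E) : toggle S e ⊆ E := by
  by_cases h : e ∈ S
  · simpa only [toggle, h, if_true] using (Finset.erase_subset _ _).trans hS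
  · simpa only [toggle, h, if_false] using Finset.insert_subset he hS

theorem isDependentOnLater_toggle {e x : ι} (h : w x ≤ w e) :
    IsDependentOnLater φ w (toggle S e) x ↔ IsDependentOnLater φ w S x := by
  have : (toggle S e).filter (fun s => w s < w x) = S.filter (fun s => w s < w x) := by
    ext s
    by_cases hs : s = e
    · subst hs
      simp [not_lt.mpr h]
    · by_cases h' : e ∈ S <;> simp [toggle, h', hs]
  rw [IsDependentOnLater, this, IsDependentOnLater]

theorem codim_toggle {e : ι} (h : IsDependentOnLater φ w S e) :
    codim φ (toggle S e) = codim φ S := by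
  have key : ∀ T : Finset ι, e ∉ T → IsDependentOnLater φ w T e →
      codim φ (insert e T) = codim φ T := fun T _ hT =>
    codim_insert_of_le ((Finset.inf_mono (Finset.filter_subset _ _)).trans hT)
  by_cases he : e ∈ S
  · have h1 := (isDependentOnLater_toggle (S := S) (le_refl (w e))).mpr h
    simp only [toggle, he, if_true] at h1 ⊢
    rw [← key _ (by simp) h1, Finset.insert_erase he]
  · simp only [toggle, he, if_false]
    exact key S he h

open Classical in
/-- **Whitney's broken circuit theorem.** If `S` contains a broken circuit, toggle the last `e`
that depends on the members of `S` after it; this changes neither the intersection nor which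
elements from `e` on are dependent in this sense, so it is an involution and these `S` cancel. -/
theorem sum_neg_one_pow_card_eq_card_isNBC [FiniteDimensional F V] (hw : Function.Injective w)
    (E : Finset ι) (k : ℕ) :
    ∑ S ∈ E.powerset with codim φ S = k, (-1 : ℤ) ^ S.card =
      (-1) ^ k * ((E.powersetCard k).filter (IsNBC φ w E)).card := by
  have hsel : ∀ S : Finset ι, ¬ IsNBC φ w E S → ∃ e ∈ E, IsDependentOnLater φ w S e ∧
      ∀ x ∈ E, IsDependentOnLater φ w S x → w e ≤ w x := by
    intro S hS
    obtain ⟨e, he, hmin⟩ := (E.filter (IsDependentOnLater φ w S)).exists_min_image w (by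
      simp only [IsNBC, not_forall, not_not] at hS
      obtain ⟨e, he, h⟩ := hS
      exact ⟨e, Finset.mem_filter.mpr ⟨he, h⟩⟩)
    rw [Finset.mem_filter] at he
    exact ⟨e, he.1, he.2, fun x hx h => hmin x (Finset.mem_filter.mpr ⟨hx, h⟩)⟩
  choose pick hpE hpD hpmin using hsel
  have hnbc : ∀ S (hS : ¬ IsNBC φ w E S), ¬ IsNBC φ w E (toggle S (pick S hS)) := fun S hS h =>
    h _ (hpE S hS) ((isDependentOnLater_toggle le_rfl).mpr (hpD S hS))
  have hpick : ∀ S (hS : ¬ IsNBC φ w E S),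
      pick (toggle S (pick S hS)) (hnbc S hS) = pick S hS := by
    intro S hS
    have hT := hnbc S hS
    have h1 : w (pick (toggle S (pick S hS)) hT) ≤ w (pick S hS) :=
      hpmin _ hT _ (hpE S hS) ((isDependentOnLater_toggle le_rfl).mpr (hpD S hS))
    exact hw (le_antisymm h1
      (hpmin S hS _ (hpE _ hT) ((isDependentOnLater_toggle h1).mp (hpD _ hT))))
  have hcancel : ∑ S ∈ E.powerset with codim φ S = k ∧ ¬ IsNBC φ w E S, (-1 : ℤ) ^ S.card = 0 := by
    refine Finset.sum_involution
      (fun S hS => toggle S (pick S (Finset.mem_filter.mp hS).2.2)) ?_ ?_ ?_ ?_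
    · exact fun S _ => neg_one_pow_card_toggle _ _
    · exact fun S _ _ => toggle_ne _ _
    · intro S hS
      simp only [Finset.mem_filter, Finset.mem_powerset] at hS ⊢
      exact ⟨toggle_subset hS.1 (hpE S hS.2.2),
        (codim_toggle (hpD S hS.2.2)).trans hS.2.1, hnbc S hS.2.2⟩
    · intro S hS
      simp only [Finset.mem_filter] at hS
      simp only [hpick S hS.2.2, toggle_toggle]
  rw [← Finset.sum_filter_add_sum_filter_not _ (IsNBC φ w E), Finset.filter_filter,
    Finset.filter_filter, hcancel, add_zero]
  have hset : (E.powerset.filter fun S => codim φ S = k ∧ IsNBC φ w E S) =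
      (E.powersetCard k).filter (IsNBC φ w E) := by
    ext S
    simp only [Finset.mem_filter, Finset.mem_powerset, Finset.mem_powersetCard]
    constructor
    · rintro ⟨h1, h2, h3⟩
      exact ⟨⟨h1, by rw [← codim_eq_card_of_isNBC hw h1 h3, h2]⟩, h3⟩
    · rintro ⟨⟨h1, h2⟩, h3⟩
      exact ⟨h1, by rw [codim_eq_card_of_isNBC hw h1 h3, h2], h3⟩
  rw [hset, Finset.sum_congr rfl (g := fun _ => (-1 : ℤ) ^ k), Finset.sum_const, nsmul_eq_mul,
    mul_comm]
  intro S hS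
  rw [(Finset.mem_powersetCard.mp (Finset.mem_filter.mp hS).1).2]

end NBC

variable {n : ℕ}

/-! ### The resonance arrangement as kernels of linear forms -/

/-- The linear form `x ↦ ∑ i ∈ I, x i`, whose kernel is `hyperplane I`. -/
def sumOn (I : Finset (Fin n)) : Module.Dual ℝ (Fin n → ℝ) := ∑ i ∈ I, LinearMap.proj i

/-- The `0/1`-vector of `I`, that is the coefficient vector of `sumOn I`. -/
def ind (I : Finset (Fin n)) (i : Fin n) : ℝ := if i ∈ I then 1 else 0

theorem sumOn_apply (I : Finset (Fin n)) (x : Fin n → ℝ) : sumOn I x = ∑ i ∈ I, x i := by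
  simp [sumOn]

theorem sumOn_eq_sum_ind (I : Finset (Fin n)) (x : Fin n → ℝ) :
    sumOn I x = ∑ i, ind I i * x i := by
  simp [sumOn_apply, ind]

theorem sumOn_single (I : Finset (Fin n)) (i : Fin n) : sumOn I (Pi.single i 1) = ind I i := by
  simp [sumOn_eq_sum_ind, Pi.single_apply]

theorem hyperplane_eq_ker (I : Finset (Fin n)) : hyperplane I = LinearMap.ker (sumOn I) := by
  ext x
  rw [LinearMap.mem_ker, sumOn_apply]
  rfl

theorem ind_of_mem {I : Finset (Fin n)} {i : Fin n} (h : i ∈ I) : ind I i = 1 := if_pos h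

theorem ind_of_notMem {I : Finset (Fin n)} {i : Fin n} (h : i ∉ I) : ind I i = 0 := if_neg h

theorem ind_eq_zero_or_one (I : Finset (Fin n)) (i : Fin n) : ind I i = 0 ∨ ind I i = 1 := by
  by_cases h : i ∈ I <;> simp [ind, h]

theorem hyperplane_injective : Function.Injective (hyperplane (n := n)) := by
  have key : ∀ I J : Finset (Fin n), hyperplane I = hyperplane J → I ⊆ J := by
    intro I J h i hi
    by_contra hiJ
    -- The basis vector at `i` lies in `hyperplane J` but not in `hyperplane I`.
    have h1 : (Pi.single i 1 : Fin n → ℝ) ∈ hyperplane J := by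
      rw [hyperplane_eq_ker, LinearMap.mem_ker, sumOn_single, ind_of_notMem hiJ]
    rw [← h, hyperplane_eq_ker, LinearMap.mem_ker, sumOn_single, ind_of_mem hi] at h1
    exact one_ne_zero h1
  exact fun I J h => Finset.Subset.antisymm (key I J h) (key J I h.symm)

/-- The nonempty subsets of `Fin n`, which index the resonance arrangement. -/
def nonemptySets (n : ℕ) : Finset (Finset (Fin n)) := Finset.univ.filter fun I => I.Nonempty

theorem mem_nonemptySets {I : Finset (Fin n)} : I ∈ nonemptySets n ↔ I.Nonempty := by
  simp [nonemptySets]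

open Classical in
theorem rank_image_hyperplane (S : Finset (Finset (Fin n))) :
    rank (S.image hyperplane) = codim sumOn S := by
  rw [rank, codim, Finset.inf_image]
  have : (id ∘ hyperplane : Finset (Fin n) → _) = fun I => LinearMap.ker (sumOn I) := by
    ext1 I
    exact hyperplane_eq_ker I
  rw [this]

theorem rank_resonance (n : ℕ) : rank (resonance n) = n := by
  classical
  have : (resonance n).inf id = ⊥ := by
    rw [eq_bot_iff]
    intro x hx
    rw [Submodule.mem_bot]
    ext i
    have h : (resonance n).inf id ≤ hyperplane {i} := Finset.inf_le (f := id) (by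
      rw [resonance]
      exact Finset.mem_image_of_mem _ (by simp))
    have h1 := h hx
    rw [hyperplane_eq_ker, LinearMap.mem_ker, sumOn_apply] at h1
    simpa using h1
  rw [rank, this]
  have h := Submodule.finrank_quotient_add_finrank (⊥ : Submodule ℝ (Fin n → ℝ))
  simpa using h

theorem codim_le (S : Finset (Finset (Fin n))) : codim sumOn S ≤ n := by
  have h := Submodule.finrank_quotient_le (S.inf fun i => LinearMap.ker (sumOn i))
  simpa [codim] using h

open Classical in
/-- Sets are ordered by `toColex`, bigger ones first: this extends reverse inclusion. -/
theorem betti_resonance {k : ℕ} (hk : k ≤ n) :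
    betti (resonance n) k = (((nonemptySets n).powersetCard k).filter
      (IsNBC sumOn toColex (nonemptySets n))).card := by
  have h1 : (charPoly (resonance n)).coeff (n - k) =
      ∑ S ∈ (nonemptySets n).powerset with codim sumOn S = k, (-1 : ℤ) ^ S.card := by
    rw [charPoly, rank_resonance, resonance, Finset.powerset_image,
      Finset.sum_image (fun S _ T _ h => Finset.image_injective hyperplane_injective h),
      Polynomial.finsetSum_coeff, Finset.sum_filter]
    refine Finset.sum_congr rfl fun S _ => ?_
    rw [rank_image_hyperplane, Finset.card_image_of_injective _ hyperplane_injective]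
    have hC : ((-1 : ℤ[X]) ^ S.card) = Polynomial.C ((-1 : ℤ) ^ S.card) := by simp
    rw [hC, Polynomial.coeff_C_mul_X_pow]
    have := codim_le S
    exact if_congr (by omega) rfl rfl
  rw [betti, if_pos hk, h1, sum_neg_one_pow_card_eq_card_isNBC toColex.injective,
    Int.natAbs_mul, Int.natAbs_pow]
  simp

/-! ### Broken circuits of two and three sets -/

section Dependence

variable {a b c e : Finset (Fin n)} {S : Finset (Finset (Fin n))}

theorem isDependentOnLater_of_ind_eq {α β γ : ℝ} (ha : a ∈ S) (hb : b ∈ S) (hc : c ∈ S)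
    (hae : toColex a < toColex e) (hbe : toColex b < toColex e) (hce : toColex c < toColex e)
    (h : ∀ i, ind e i = α * ind a i + β * ind b i + γ * ind c i) :
    IsDependentOnLater sumOn toColex S e := by
  intro x hx
  have hmem : ∀ s ∈ S, toColex s < toColex e → sumOn s x = 0 := fun s hs hlt => by
    have := Finset.inf_le (f := fun i => LinearMap.ker (sumOn i))
      (Finset.mem_filter.mpr ⟨hs, hlt⟩) hx
    simpa using this
  rw [LinearMap.mem_ker]
  have : sumOn e x = α * sumOn a x + β * sumOn b x + γ * sumOn c x := by
    simp only [sumOn_eq_sum_ind, h, Finset.mul_sum, ← Finset.sum_add_distrib]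
    exact Finset.sum_congr rfl fun i _ => by ring
  rw [this, hmem a ha hae, hmem b hb hbe, hmem c hc hce]
  simp

theorem exists_ind_eq_of_isDependentOnLater (h : IsDependentOnLater sumOn toColex S e) :
    ∃ g : Finset (Fin n) → ℝ, (∀ s, g s ≠ 0 → toColex s < toColex e) ∧
      ∀ i, ind e i = ∑ s ∈ S, g s * ind s i := by
  classical
  set T := S.filter fun s => toColex s < toColex e with hT
  have h1 : (⨅ s : T, LinearMap.ker (sumOn (s : Finset (Fin n)))) ≤ LinearMap.ker (sumOn e) := by
    refine le_trans (Finset.le_inf fun s hs => ?_) h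
    exact iInf_le (fun s : T => LinearMap.ker (sumOn (s : Finset (Fin n)))) ⟨s, hs⟩
  obtain ⟨g, hg⟩ := (Submodule.mem_span_range_iff_exists_fun ℝ).1 (mem_span_of_iInf_ker_le_ker h1)
  refine ⟨fun s => if hs : s ∈ T then g ⟨s, hs⟩ else 0, fun s hs => ?_, fun i => ?_⟩
  · by_cases hsT : s ∈ T
    · exact (Finset.mem_filter.mp hsT).2
    · simp [hsT] at hs
  · rw [← sumOn_single, ← hg, ← Finset.sum_subset (Finset.filter_subset _ S : T ⊆ S),
      ← Finset.sum_coe_sort T]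
    · simp [sumOn_single]
    · intro s _ hs
      simp [show s ∉ T from hs]

theorem toColex_le_of_subset (h : a ⊆ b) : toColex a ≤ toColex b :=
  Finset.Colex.toColex_mono h

theorem exists_mem_notMem_of_toColex_lt (h : toColex a < toColex e) : ∃ i ∈ e, i ∉ a := by
  by_contra! h'
  exact absurd (toColex_le_of_subset h') (not_le.mpr h)

/-- No nonempty set is a combination of those of two intersecting sets that come after it. -/
theorem not_ind_eq_pair {α β : ℝ} (he : e.Nonempty) (hab : ¬ Disjoint a b)
    (ha : α ≠ 0 → toColex a < toColex e) (hb : β ≠ 0 → toColex b < toColex e)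
    (h : ∀ i, ind e i = α * ind a i + β * ind b i) : False := by
  have h1 : α ≠ 0 → β = 1 := fun h0 => by
    obtain ⟨i, hie, hia⟩ := exists_mem_notMem_of_toColex_lt (ha h0)
    have := h i
    rw [ind_of_mem hie, ind_of_notMem hia] at this
    rcases ind_eq_zero_or_one b i with hb | hb <;> rw [hb] at this <;> linarith
  have h2 : β ≠ 0 → α = 1 := fun h0 => by
    obtain ⟨i, hie, hib⟩ := exists_mem_notMem_of_toColex_lt (hb h0)
    have := h i
    rw [ind_of_mem hie, ind_of_notMem hib] at this
    rcases ind_eq_zero_or_one a i with ha | ha <;> rw [ha] at this <;> linarith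
  obtain ⟨p, hpa, hpb⟩ := Finset.not_disjoint_iff.mp hab
  obtain ⟨q, hq⟩ := he
  have hp := h p
  have hq' := h q
  rw [ind_of_mem hpa, ind_of_mem hpb] at hp
  rw [ind_of_mem hq] at hq'
  by_cases hα : α = 0
  · by_cases hβ : β = 0
    · simp [hα, hβ] at hq'
    · linarith [h2 hβ]
  · have hβ := h1 hα
    have hα' := h2 (by rw [hβ]; exact one_ne_zero)
    rcases ind_eq_zero_or_one e p with h0 | h0 <;> rw [h0] at hp <;> linarith

/-- The relation `1_a + 1_b = 1_c + 1_e` between `0/1`-vectors. -/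
def PairSumEq (a b c e : Finset (Fin n)) : Prop := a ∩ b = c ∩ e ∧ a ∪ b = c ∪ e

theorem pairSumEq_iff_ind : PairSumEq a b c e ↔ ∀ i, ind a i + ind b i = ind c i + ind e i := by
  simp only [PairSumEq, Finset.ext_iff, ← forall_and, Finset.mem_inter, Finset.mem_union]
  refine forall_congr' fun i => ?_
  by_cases ha : i ∈ a <;> by_cases hb : i ∈ b <;> by_cases hc : i ∈ c <;> by_cases he : i ∈ e <;>
    simp [ind, ha, hb, hc, he]
  norm_num

/-- Every point of `a ∪ b ∪ c` lies in exactly two of `a`, `b`, `c`: half the sum of their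
`0/1`-vectors is the `0/1`-vector of `a ∪ b ∪ c`. -/
def CoverTwice (a b c : Finset (Fin n)) : Prop :=
  ∀ i, ¬ (i ∈ a ∧ i ∈ b ∧ i ∈ c) ∧ (i ∈ a → i ∈ b ∨ i ∈ c) ∧ (i ∈ b → i ∈ a ∨ i ∈ c) ∧
    (i ∈ c → i ∈ a ∨ i ∈ b)

/-- `a`, `b`, `c` are completed by a set before all of them to a relation `PairSumEq`, in which
`c` stands on the side of the new set. -/
def HasEarlierPartner (a b c : Finset (Fin n)) : Prop :=
  ∃ e, (toColex a < toColex e ∧ toColex b < toColex e ∧ toColex c < toColex e) ∧ PairSumEq a b c e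

theorem coverTwice_of_ind (h : ∀ i, 2 * ind e i = ind a i + ind b i + ind c i) :
    CoverTwice a b c := by
  intro i
  have := h i
  by_cases ha : i ∈ a <;> by_cases hb : i ∈ b <;> by_cases hc : i ∈ c <;> by_cases he : i ∈ e <;>
    simp [ind, ha, hb, hc, he] at this ⊢ <;> norm_num at this

theorem CoverTwice.ind_union (h : CoverTwice a b c) (i : Fin n) :
    ind (a ∪ b ∪ c) i = 1 / 2 * ind a i + 1 / 2 * ind b i + 1 / 2 * ind c i := by
  have := h i
  by_cases ha : i ∈ a <;> by_cases hb : i ∈ b <;> by_cases hc : i ∈ c <;>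
    simp [ind, ha, hb, hc] at this ⊢ <;> norm_num

/-- If `1_e + 2 * 1_c = 1_a + 1_b` then `c = a ∩ b`, and `a ∪ b` completes `a`, `b`, `c`. -/
theorem hasEarlierPartner_of_ind_add_two_mul (ha : toColex a < toColex e)
    (hb : toColex b < toColex e) (hc : toColex c < toColex e)
    (h : ∀ i, ind e i + 2 * ind c i = ind a i + ind b i) : HasEarlierPartner a b c := by
  have hsub : e ⊆ a ∪ b := by
    intro i hi
    have := h i
    by_contra hn
    simp only [Finset.mem_union, not_or] at hn
    rw [ind_of_mem hi, ind_of_notMem hn.1, ind_of_notMem hn.2] at this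
    rcases ind_eq_zero_or_one c i with h0 | h0 <;> rw [h0] at this <;> linarith
  have hle := toColex_le_of_subset hsub
  refine ⟨a ∪ b, ⟨ha.trans_le hle, hb.trans_le hle, hc.trans_le hle⟩,
    pairSumEq_iff_ind.mpr fun i => ?_⟩
  have := h i
  by_cases ha : i ∈ a <;> by_cases hb : i ∈ b <;> by_cases hc : i ∈ c <;> by_cases he : i ∈ e <;>
    simp [ind, ha, hb, hc, he] at this ⊢ <;> norm_num at this

/-- If `e`, before three pairwise intersecting sets, is a combination of them, few coefficients are
possible: `e` has a point outside each of the sets, and each two of them have a common point. -/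
theorem coverTwice_or_hasEarlierPartner {α β γ : ℝ} (hab : ¬ Disjoint a b) (hac : ¬ Disjoint a c)
    (hbc : ¬ Disjoint b c) (hα : α ≠ 0) (hβ : β ≠ 0) (hγ : γ ≠ 0)
    (ha : toColex a < toColex e) (hb : toColex b < toColex e) (hc : toColex c < toColex e)
    (h : ∀ i, ind e i = α * ind a i + β * ind b i + γ * ind c i) :
    CoverTwice a b c ∨ HasEarlierPartner a b c ∨ HasEarlierPartner a c b ∨
      HasEarlierPartner b c a := by
  have h1 : β = 1 ∨ γ = 1 ∨ β + γ = 1 := by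
    obtain ⟨i, hie, hi⟩ := exists_mem_notMem_of_toColex_lt ha
    have := h i
    rw [ind_of_mem hie, ind_of_notMem hi] at this
    rcases ind_eq_zero_or_one b i with h1 | h1 <;> rcases ind_eq_zero_or_one c i with h2 | h2 <;>
      rw [h1, h2] at this <;> grind
  have h2 : α = 1 ∨ γ = 1 ∨ α + γ = 1 := by
    obtain ⟨i, hie, hi⟩ := exists_mem_notMem_of_toColex_lt hb
    have := h i
    rw [ind_of_mem hie, ind_of_notMem hi] at this
    rcases ind_eq_zero_or_one a i with h1 | h1 <;> rcases ind_eq_zero_or_one c i with h2 | h2 <;>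
      rw [h1, h2] at this <;> grind
  have h3 : α = 1 ∨ β = 1 ∨ α + β = 1 := by
    obtain ⟨i, hie, hi⟩ := exists_mem_notMem_of_toColex_lt hc
    have := h i
    rw [ind_of_mem hie, ind_of_notMem hi] at this
    rcases ind_eq_zero_or_one a i with h1 | h1 <;> rcases ind_eq_zero_or_one b i with h2 | h2 <;>
      rw [h1, h2] at this <;> grind
  by_cases hcom : ∃ p, p ∈ a ∧ p ∈ b ∧ p ∈ c
  · obtain ⟨p, hpa, hpb, hpc⟩ := hcom
    have hp := h p
    rw [ind_of_mem hpa, ind_of_mem hpb, ind_of_mem hpc] at hp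
    rcases ind_eq_zero_or_one e p with h0 | h0 <;> rw [h0] at hp
    · have : (α = 1 ∧ β = 1 ∧ γ = -2) ∨ (α = 1 ∧ γ = 1 ∧ β = -2) ∨
          (β = 1 ∧ γ = 1 ∧ α = -2) := by
        clear h ha hb hc hab hac hbc hpa hpb hpc
        have hα' : α ≠ -1 := by grind
        have hβ' : β ≠ -1 := by grind
        have hγ' : γ ≠ -1 := by grind
        have h1' : β = 1 ∨ γ = 1 := by grind
        have h2' : α = 1 ∨ γ = 1 := by grind
        have h3' : α = 1 ∨ β = 1 := by grind
        grind
      rcases this with ⟨rfl, rfl, rfl⟩ | ⟨rfl, rfl, rfl⟩ | ⟨rfl, rfl, rfl⟩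
      · exact .inr <| .inl <| hasEarlierPartner_of_ind_add_two_mul ha hb hc
          fun i => by linarith [h i]
      · exact .inr <| .inr <| .inl <| hasEarlierPartner_of_ind_add_two_mul ha hc hb
          fun i => by linarith [h i]
      · exact .inr <| .inr <| .inr <| hasEarlierPartner_of_ind_add_two_mul hb hc ha
          fun i => by linarith [h i]
    · have : (α = 1 ∧ β = 1 ∧ γ = -1) ∨ (α = 1 ∧ γ = 1 ∧ β = -1) ∨
          (β = 1 ∧ γ = 1 ∧ α = -1) := by grind
      rcases this with ⟨rfl, rfl, rfl⟩ | ⟨rfl, rfl, rfl⟩ | ⟨rfl, rfl, rfl⟩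
      · exact .inr <| .inl ⟨e, ⟨ha, hb, hc⟩, pairSumEq_iff_ind.mpr fun i => by linarith [h i]⟩
      · exact .inr <| .inr <| .inl ⟨e, ⟨ha, hc, hb⟩,
          pairSumEq_iff_ind.mpr fun i => by linarith [h i]⟩
      · exact .inr <| .inr <| .inr ⟨e, ⟨hb, hc, ha⟩,
          pairSumEq_iff_ind.mpr fun i => by linarith [h i]⟩
  · left
    push Not at hcom
    obtain ⟨p, hpa, hpb⟩ := Finset.not_disjoint_iff.mp hab
    obtain ⟨q, hqa, hqc⟩ := Finset.not_disjoint_iff.mp hac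
    obtain ⟨r, hrb, hrc⟩ := Finset.not_disjoint_iff.mp hbc
    have hp := h p
    have hq := h q
    have hr := h r
    rw [ind_of_mem hpa, ind_of_mem hpb, ind_of_notMem (hcom p hpa hpb)] at hp
    rw [ind_of_mem hqa, ind_of_notMem fun hqb => hcom q hqa hqb hqc, ind_of_mem hqc] at hq
    rw [ind_of_notMem fun hra => hcom r hra hrb hrc, ind_of_mem hrb, ind_of_mem hrc] at hr
    have : α = 1 / 2 ∧ β = 1 / 2 ∧ γ = 1 / 2 := by
      rcases ind_eq_zero_or_one e p with h4 | h4 <;> rcases ind_eq_zero_or_one e q with h5 | h5 <;>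
        rcases ind_eq_zero_or_one e r with h6 | h6 <;> rw [h4] at hp <;> rw [h5] at hq <;>
        rw [h6] at hr <;> grind
    obtain ⟨rfl, rfl, rfl⟩ := this
    exact coverTwice_of_ind (e := e) fun i => by linarith [h i]

theorem toColex_lt_union_left (hb : ¬ b ⊆ a) : toColex a < toColex (a ∪ b) :=
  Finset.Colex.toColex_strictMono
    (Finset.ssubset_iff_subset_ne.mpr ⟨Finset.subset_union_left, fun h => hb (by
      rw [h]; exact Finset.subset_union_right)⟩)

theorem not_isNBC_of_disjoint (ha : a ∈ S) (hb : b ∈ S) (ha0 : a.Nonempty) (hb0 : b.Nonempty)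
    (hab : Disjoint a b) : ¬ IsNBC sumOn toColex (nonemptySets n) S := by
  intro h
  have hlt : ∀ s t : Finset (Fin n), t.Nonempty → Disjoint s t → toColex s < toColex (s ∪ t) := by
    intro s t ht hst
    refine toColex_lt_union_left fun hts => ht.ne_empty ?_
    exact Finset.disjoint_self_iff_empty t |>.mp (hst.mono_left hts)
  have h1 := hlt a b hb0 hab
  have h2 : toColex b < toColex (a ∪ b) := by
    rw [Finset.union_comm]
    exact hlt b a ha0 hab.symm
  refine h (a ∪ b) (mem_nonemptySets.mpr (ha0.mono Finset.subset_union_left))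
    (isDependentOnLater_of_ind_eq (α := 1) (β := 1) (γ := 0) ha hb hb h1 h2 h2 fun i => ?_)
  by_cases hia : i ∈ a
  · simp [ind, hia, Finset.disjoint_left.mp hab hia]
  · simp [ind, hia]

theorem isNBC_pair_iff (ha : a.Nonempty) (hb : b.Nonempty) (hne : a ≠ b) :
    IsNBC sumOn toColex (nonemptySets n) {a, b} ↔ ¬ Disjoint a b := by
  refine ⟨fun h hd => not_isNBC_of_disjoint (by simp) (by simp) ha hb hd h, fun h e he hdep => ?_⟩
  obtain ⟨g, hg, hsum⟩ := exists_ind_eq_of_isDependentOnLater hdep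
  exact not_ind_eq_pair (mem_nonemptySets.mp he) h (hg a) (hg b) fun i => by
    rw [hsum, Finset.sum_pair hne]

theorem isNBC_triple_iff (ha : a.Nonempty) (hb : b.Nonempty) (hc : c.Nonempty)
    (hab : a ≠ b) (hac : a ≠ c) (hbc : b ≠ c) :
    IsNBC sumOn toColex (nonemptySets n) {a, b, c} ↔
      (¬ Disjoint a b ∧ ¬ Disjoint a c ∧ ¬ Disjoint b c) ∧ ¬ CoverTwice a b c ∧
        ¬ HasEarlierPartner a b c ∧ ¬ HasEarlierPartner a c b ∧ ¬ HasEarlierPartner b c a := by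
  constructor
  · intro h
    have h1 : ¬ Disjoint a b := fun hd =>
      not_isNBC_of_disjoint (by simp) (by simp) ha hb hd h
    have h2 : ¬ Disjoint a c := fun hd =>
      not_isNBC_of_disjoint (by simp) (by simp) ha hc hd h
    have h3 : ¬ Disjoint b c := fun hd =>
      not_isNBC_of_disjoint (by simp) (by simp) hb hc hd h
    have key : ∀ x y z : Finset (Fin n), x ∈ ({a, b, c} : Finset (Finset (Fin n))) →
        y ∈ ({a, b, c} : Finset (Finset (Fin n))) → z ∈ ({a, b, c} : Finset (Finset (Fin n))) →
        x.Nonempty → ¬ HasEarlierPartner x y z := by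
      rintro x y z hx hy hz hx0 ⟨e, ⟨hxe, hye, hze⟩, hr⟩
      have he : e.Nonempty := by
        obtain ⟨i, hi, -⟩ := exists_mem_notMem_of_toColex_lt hxe
        exact ⟨i, hi⟩
      refine h e (mem_nonemptySets.mpr he) (isDependentOnLater_of_ind_eq (α := 1) (β := 1)
        (γ := -1) hx hy hz hxe hye hze fun i => ?_)
      linarith [pairSumEq_iff_ind.mp hr i]
    refine ⟨⟨h1, h2, h3⟩, fun ht => ?_, key _ _ _ (by simp) (by simp) (by simp) ha,
      key _ _ _ (by simp) (by simp) (by simp) ha, key _ _ _ (by simp) (by simp) (by simp) hb⟩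
    -- A common point of two of the sets lies outside the third.
    obtain ⟨p, hpa, hpb⟩ := Finset.not_disjoint_iff.mp h1
    obtain ⟨q, hqa, hqc⟩ := Finset.not_disjoint_iff.mp h2
    obtain ⟨r, hrb, hrc⟩ := Finset.not_disjoint_iff.mp h3
    refine h (a ∪ b ∪ c) (mem_nonemptySets.mpr ⟨p, by simp [hpa]⟩)
      (isDependentOnLater_of_ind_eq (by simp) (by simp) (by simp) ?_ ?_ ?_ ht.ind_union)
    · rw [Finset.union_assoc]
      exact toColex_lt_union_left fun hs =>
        (ht r).1 ⟨hs (by simp [hrb]), hrb, hrc⟩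
    · rw [Finset.union_comm a b, Finset.union_assoc]
      exact toColex_lt_union_left fun hs =>
        (ht q).1 ⟨hqa, hs (by simp [hqa]), hqc⟩
    · rw [Finset.union_comm]
      exact toColex_lt_union_left fun hs =>
        (ht p).1 ⟨hpa, hpb, hs (by simp [hpa])⟩
  · rintro ⟨⟨h1, h2, h3⟩, h4, h5, h6, h7⟩ e he hdep
    obtain ⟨g, hg, hsum⟩ := exists_ind_eq_of_isDependentOnLater hdep
    have hrel : ∀ i, ind e i = g a * ind a i + g b * ind b i + g c * ind c i := fun i => by
      rw [hsum, Finset.sum_insert (by simp [hab, hac]), Finset.sum_pair hbc, add_assoc]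
    have he' := mem_nonemptySets.mp he
    by_cases hα : g a = 0
    · exact not_ind_eq_pair he' h3 (hg b) (hg c) fun i => by rw [hrel, hα]; ring
    by_cases hβ : g b = 0
    · exact not_ind_eq_pair he' h2 (hg a) (hg c) fun i => by rw [hrel, hβ]; ring
    by_cases hγ : g c = 0
    · exact not_ind_eq_pair he' h1 (hg a) (hg b) fun i => by rw [hrel, hγ]; ring
    rcases coverTwice_or_hasEarlierPartner h1 h2 h3 hα hβ hγ (hg a hα) (hg b hβ) (hg c hγ) hrel
      with h | h | h | h
    · exact h4 h
    · exact h5 h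
    · exact h6 h
    · exact h7 h

end Dependence

/-! ### Counting tuples of sets by columns -/

section Tuples

/-- A set of `k` elements has `k!` enumerations. -/
theorem card_tuples_image_eq {ι : Type*} [Fintype ι] [DecidableEq ι] {k : ℕ} {S : Finset ι}
    (hS : S.card = k) :
    (Finset.univ.filter fun f : Fin k → ι => Finset.univ.image f = S).card = k.factorial := by
  have h1 : Fintype.card (Fin k ↪ S) = k.factorial := by
    rw [Fintype.card_embedding_eq, Fintype.card_fin, Fintype.card_coe, hS, Nat.descFactorial_self]
  rw [← h1, ← Finset.card_univ]
  symm
  refine Finset.card_bij (fun e _ j => (e j : ι)) (fun e _ => ?_) (fun e _ e' _ h => ?_)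
    (fun f hf => ?_)
  · rw [Finset.mem_filter]
    refine ⟨Finset.mem_univ _, Finset.eq_of_subset_of_card_le ?_ ?_⟩
    · exact Finset.image_subset_iff.mpr fun j _ => (e j).2
    · rw [Finset.card_image_of_injective Finset.univ (f := fun j => (e j : ι))
        (Subtype.val_injective.comp e.injective), hS]
      simp
  · ext j
    exact congrFun h j
  · have himg := (Finset.mem_filter.mp hf).2
    have hinj : Function.Injective f := by
      rw [← Set.injOn_univ, ← Finset.coe_univ, ← Finset.card_image_iff, himg, hS]
      simp
    have hmem : ∀ j, f j ∈ S := fun j => himg ▸ Finset.mem_image_of_mem f (Finset.mem_univ j)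
    exact ⟨⟨fun j => ⟨f j, hmem j⟩, fun i j h => hinj (congrArg Subtype.val h)⟩,
      Finset.mem_univ _, rfl⟩

theorem card_tuples_image_mem {ι : Type*} [Fintype ι] [DecidableEq ι] {k : ℕ}
    (X : Finset (Finset ι)) (hX : ∀ S ∈ X, S.card = k) :
    (Finset.univ.filter fun f : Fin k → ι => Finset.univ.image f ∈ X).card =
      k.factorial * X.card := by
  rw [Finset.card_eq_sum_card_fiberwise (f := fun f => Finset.univ.image f) (t := X)
    (fun f hf => by simpa using hf), Finset.sum_const_nat (m := k.factorial), mul_comm]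
  intro S hS
  rw [← card_tuples_image_eq (hX S hS), Finset.filter_filter]
  congr 1
  ext f
  simp only [Finset.mem_filter, Finset.mem_univ, true_and, and_iff_right_iff_imp]
  rintro rfl
  exact hS

/-- The number of `k`-tuples of subsets of `Fin n` with the property `Q`. -/
def tupleCount {k : ℕ} (Q : (Fin k → Finset (Fin n)) → Prop) : ℤ :=
  open Classical in ∑ f, if Q f then 1 else 0

theorem tupleCount_congr {k : ℕ} {Q Q' : (Fin k → Finset (Fin n)) → Prop} (h : ∀ f, Q f ↔ Q' f) :
    tupleCount Q = tupleCount Q' := by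
  rw [funext fun f => propext (h f)]

open Classical in
theorem tupleCount_eq_card {k : ℕ} (Q : (Fin k → Finset (Fin n)) → Prop) :
    tupleCount Q = (Finset.univ.filter Q).card := by
  rw [tupleCount, Finset.sum_boole]

theorem factorial_mul_card_eq_tupleCount {k : ℕ} (X : Finset (Finset (Finset (Fin n))))
    (hX : ∀ S ∈ X, S.card = k) :
    (k.factorial : ℤ) * X.card = tupleCount fun f : Fin k → _ => Finset.univ.image f ∈ X := by
  classical
  rw [tupleCount_eq_card]
  have := card_tuples_image_mem X hX
  rw [← Nat.cast_mul, ← this]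
  congr!

/-- A `k`-tuple of subsets of `Fin n` amounts to the `n` columns of its membership table. A
condition that asks each column to be one of `m` patterns is met by `m ^ n` tuples. -/
theorem tupleCount_of_columns {k : ℕ} (m : ℤ) (P : (Fin k → Bool) → Bool)
    {Q : (Fin k → Finset (Fin n)) → Prop}
    (h : ∀ f, Q f ↔ ∀ i, P (fun j => decide (i ∈ f j)) = true)
    (hm : ((Finset.univ.filter fun v => P v = true).card : ℤ) = m) :
    tupleCount Q = m ^ n := by
  classical
  rw [tupleCount_eq_card]
  rw [← hm, ← Nat.cast_pow, ← Fintype.card_piFinset_const, Nat.cast_inj]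
  refine Finset.card_nbij' (fun f i j => decide (i ∈ f j))
    (fun g j => Finset.univ.filter fun i => g i j = true) ?_ ?_ ?_ ?_
  · intro f hf
    simpa [h] using hf
  · intro g hg
    simpa [h] using hg
  · intro f _
    ext j i
    simp
  · intro g _
    ext i j
    simp

theorem tupleCount_and_not {k : ℕ} (C A : (Fin k → Finset (Fin n)) → Prop) :
    tupleCount (fun f => C f ∧ ¬ A f) = tupleCount C - tupleCount fun f => C f ∧ A f := by
  simp only [tupleCount, ← Finset.sum_sub_distrib]
  refine Finset.sum_congr rfl fun f _ => ?_
  by_cases h : C f <;> by_cases h1 : A f <;> simp [h, h1]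

theorem tupleCount_and_not_and_not {k : ℕ} (C A B : (Fin k → Finset (Fin n)) → Prop) :
    tupleCount (fun f => C f ∧ ¬ A f ∧ ¬ B f) = tupleCount C - tupleCount (fun f => C f ∧ A f)
      - tupleCount (fun f => C f ∧ B f) + tupleCount fun f => C f ∧ A f ∧ B f := by
  simp only [tupleCount, ← Finset.sum_sub_distrib, ← Finset.sum_add_distrib]
  refine Finset.sum_congr rfl fun f _ => ?_
  by_cases h : C f <;> by_cases h1 : A f <;> by_cases h2 : B f <;> simp [h, h1, h2]

theorem tupleCount_and_not_and_not_and_not {k : ℕ} (C A B D : (Fin k → Finset (Fin n)) → Prop) :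
    tupleCount (fun f => C f ∧ ¬ A f ∧ ¬ B f ∧ ¬ D f) = tupleCount C
      - tupleCount (fun f => C f ∧ A f) - tupleCount (fun f => C f ∧ B f)
      - tupleCount (fun f => C f ∧ D f) + tupleCount (fun f => C f ∧ A f ∧ B f)
      + tupleCount (fun f => C f ∧ A f ∧ D f) + tupleCount (fun f => C f ∧ B f ∧ D f)
      - tupleCount fun f => C f ∧ A f ∧ B f ∧ D f := by
  simp only [tupleCount, ← Finset.sum_sub_distrib, ← Finset.sum_add_distrib]
  refine Finset.sum_congr rfl fun f _ => ?_
  by_cases h : C f <;> by_cases h1 : A f <;> by_cases h2 : B f <;> by_cases h3 : D f <;>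
    simp [h, h1, h2, h3]

end Tuples

theorem disjoint_iff_forall {a b : Finset (Fin n)} : Disjoint a b ↔ ∀ i, i ∉ a ∨ i ∉ b := by
  simp [Finset.disjoint_left, ← not_and_or]

/-! ### Intersecting pairs and triples -/

section Pairs

theorem tupleCount_intersecting_pairs :
    tupleCount (fun f : Fin 2 → Finset (Fin n) => ¬ Disjoint (f 0) (f 1) ∧ f 0 ≠ f 1) =
      4 ^ n - 3 ^ n - 2 ^ n + 1 := by
  have h1 : tupleCount (fun _ : Fin 2 → Finset (Fin n) => True) = _ :=
    tupleCount_of_columns 4 (fun _ => true) (by simp) (by decide)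
  have h2 : tupleCount (fun f : Fin 2 → Finset (Fin n) => True ∧ Disjoint (f 0) (f 1)) = _ :=
    tupleCount_of_columns 3 (fun v => !(v 0 && v 1)) (by simp [disjoint_iff_forall]) (by decide)
  have h3 : tupleCount (fun f : Fin 2 → Finset (Fin n) => True ∧ f 0 = f 1) = _ :=
    tupleCount_of_columns 2 (fun v => v 0 == v 1) (by simp [Finset.ext_iff]) (by decide)
  have h4 : tupleCount (fun f : Fin 2 → Finset (Fin n) =>
      True ∧ Disjoint (f 0) (f 1) ∧ f 0 = f 1) = _ :=
    tupleCount_of_columns 1 (fun v => !(v 0 && v 1) && (v 0 == v 1))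
      (by simp [disjoint_iff_forall, Finset.ext_iff, forall_and]) (by decide)
  have key := tupleCount_and_not_and_not (fun _ : Fin 2 → Finset (Fin n) => True)
    (fun f => Disjoint (f 0) (f 1)) (fun f => f 0 = f 1)
  rw [tupleCount_congr (Q' := fun f => True ∧ ¬ Disjoint (f 0) (f 1) ∧ ¬ f 0 = f 1)
    (fun f => by simp), key, h1, h2, h3, h4]
  ring

end Pairs

section Triples

/-- Three sets that intersect pairwise. -/
def IntersectingTriple (f : Fin 3 → Finset (Fin n)) : Prop :=
  ¬ Disjoint (f 0) (f 1) ∧ ¬ Disjoint (f 0) (f 2) ∧ ¬ Disjoint (f 1) (f 2)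

theorem tupleCount_intersectingTriple :
    tupleCount (IntersectingTriple (n := n)) = 8 ^ n - 3 * 6 ^ n + 3 * 5 ^ n - 4 ^ n := by
  have h0 : tupleCount (fun _ : Fin 3 → Finset (Fin n) => True) = _ :=
    tupleCount_of_columns 8 (fun _ => true) (by simp) (by decide)
  have h1 : tupleCount (fun f : Fin 3 → Finset (Fin n) => True ∧ Disjoint (f 0) (f 1)) = _ :=
    tupleCount_of_columns 6 (fun v => !(v 0 && v 1)) (by simp [disjoint_iff_forall]) (by decide)
  have h2 : tupleCount (fun f : Fin 3 → Finset (Fin n) => True ∧ Disjoint (f 0) (f 2)) = _ :=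
    tupleCount_of_columns 6 (fun v => !(v 0 && v 2)) (by simp [disjoint_iff_forall]) (by decide)
  have h3 : tupleCount (fun f : Fin 3 → Finset (Fin n) => True ∧ Disjoint (f 1) (f 2)) = _ :=
    tupleCount_of_columns 6 (fun v => !(v 1 && v 2)) (by simp [disjoint_iff_forall]) (by decide)
  have h12 : tupleCount (fun f : Fin 3 → Finset (Fin n) =>
      True ∧ Disjoint (f 0) (f 1) ∧ Disjoint (f 0) (f 2)) = _ :=
    tupleCount_of_columns 5 (fun v => !(v 0 && v 1) && !(v 0 && v 2))
      (by simp [disjoint_iff_forall, forall_and]) (by decide)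
  have h13 : tupleCount (fun f : Fin 3 → Finset (Fin n) =>
      True ∧ Disjoint (f 0) (f 1) ∧ Disjoint (f 1) (f 2)) = _ :=
    tupleCount_of_columns 5 (fun v => !(v 0 && v 1) && !(v 1 && v 2))
      (by simp [disjoint_iff_forall, forall_and]) (by decide)
  have h23 : tupleCount (fun f : Fin 3 → Finset (Fin n) =>
      True ∧ Disjoint (f 0) (f 2) ∧ Disjoint (f 1) (f 2)) = _ :=
    tupleCount_of_columns 5 (fun v => !(v 0 && v 2) && !(v 1 && v 2))
      (by simp [disjoint_iff_forall, forall_and]) (by decide)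
  have h123 : tupleCount (fun f : Fin 3 → Finset (Fin n) =>
      True ∧ Disjoint (f 0) (f 1) ∧ Disjoint (f 0) (f 2) ∧ Disjoint (f 1) (f 2)) = _ :=
    tupleCount_of_columns 4 (fun v => !(v 0 && v 1) && (!(v 0 && v 2) && !(v 1 && v 2)))
      (by simp [disjoint_iff_forall, forall_and]) (by decide)
  have key := tupleCount_and_not_and_not_and_not (fun _ : Fin 3 → Finset (Fin n) => True)
    (fun f => Disjoint (f 0) (f 1)) (fun f => Disjoint (f 0) (f 2)) (fun f => Disjoint (f 1) (f 2))
  rw [tupleCount_congr (Q' := fun f => True ∧ ¬ Disjoint (f 0) (f 1) ∧ ¬ Disjoint (f 0) (f 2) ∧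
    ¬ Disjoint (f 1) (f 2)) (fun f => by simp [IntersectingTriple]), key, h0, h1, h2, h3, h12, h13,
    h23, h123]
  ring

/-- Three distinct sets that intersect pairwise. -/
def DistinctIntersectingTriple (f : Fin 3 → Finset (Fin n)) : Prop :=
  IntersectingTriple f ∧ f 0 ≠ f 1 ∧ f 0 ≠ f 2 ∧ f 1 ≠ f 2

theorem tupleCount_distinctIntersectingTriple :
    tupleCount (DistinctIntersectingTriple (n := n)) =
      8 ^ n - 3 * 6 ^ n + 3 * 5 ^ n - 4 ^ n - 3 * (4 ^ n - 3 ^ n) + 2 * (2 ^ n - 1) := by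
  have e1 : tupleCount (fun f : Fin 3 → Finset (Fin n) => f 0 = f 1) = _ :=
    tupleCount_of_columns 4 (fun v => v 0 == v 1) (by simp [Finset.ext_iff]) (by decide)
  have e2 : tupleCount (fun f : Fin 3 → Finset (Fin n) => f 0 = f 2) = _ :=
    tupleCount_of_columns 4 (fun v => v 0 == v 2) (by simp [Finset.ext_iff]) (by decide)
  have e3 : tupleCount (fun f : Fin 3 → Finset (Fin n) => f 1 = f 2) = _ :=
    tupleCount_of_columns 4 (fun v => v 1 == v 2) (by simp [Finset.ext_iff]) (by decide)
  have d1 : tupleCount (fun f : Fin 3 → Finset (Fin n) => f 0 = f 1 ∧ Disjoint (f 0) (f 2)) = _ :=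
    tupleCount_of_columns 3 (fun v => v 0 == v 1 && !(v 0 && v 2))
      (by simp [disjoint_iff_forall, Finset.ext_iff, forall_and]) (by decide)
  have d2 : tupleCount (fun f : Fin 3 → Finset (Fin n) => f 0 = f 2 ∧ Disjoint (f 0) (f 1)) = _ :=
    tupleCount_of_columns 3 (fun v => v 0 == v 2 && !(v 0 && v 1))
      (by simp [disjoint_iff_forall, Finset.ext_iff, forall_and]) (by decide)
  have d3 : tupleCount (fun f : Fin 3 → Finset (Fin n) => f 1 = f 2 ∧ Disjoint (f 0) (f 1)) = _ :=
    tupleCount_of_columns 3 (fun v => v 1 == v 2 && !(v 0 && v 1))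
      (by simp [disjoint_iff_forall, Finset.ext_iff, forall_and]) (by decide)
  have e4 : tupleCount (fun f : Fin 3 → Finset (Fin n) => f 0 = f 1 ∧ f 0 = f 2) = _ :=
    tupleCount_of_columns 2 (fun v => v 0 == v 1 && v 0 == v 2)
      (by simp [Finset.ext_iff, forall_and]) (by decide)
  have d4 : tupleCount (fun f : Fin 3 → Finset (Fin n) =>
      (f 0 = f 1 ∧ f 0 = f 2) ∧ Disjoint (f 0) (f 1)) = _ :=
    tupleCount_of_columns 1 (fun v => v 0 == v 1 && v 0 == v 2 && !(v 0 && v 1))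
      (by simp [disjoint_iff_forall, Finset.ext_iff, forall_and]) (by decide)
  -- A set is disjoint from itself only if it is empty, and then it is disjoint from all sets.
  have self : ∀ a b : Finset (Fin n), ¬ Disjoint a b → ¬ Disjoint a a := fun a b h h' => h <| by
    rw [(Finset.disjoint_self_iff_empty a).mp h']
    exact Finset.disjoint_empty_left b
  have c1 : tupleCount (fun f : Fin 3 → Finset (Fin n) => IntersectingTriple f ∧ f 0 = f 1) =
      4 ^ n - 3 ^ n := by
    rw [← e1, ← d1, ← tupleCount_and_not]
    refine tupleCount_congr fun f => ⟨fun h => ⟨h.2, h.1.2.1⟩, ?_⟩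
    rintro ⟨h, h'⟩
    rw [IntersectingTriple, ← h]
    exact ⟨⟨self _ _ h', h', h'⟩, rfl⟩
  have c2 : tupleCount (fun f : Fin 3 → Finset (Fin n) => IntersectingTriple f ∧ f 0 = f 2) =
      4 ^ n - 3 ^ n := by
    rw [← e2, ← d2, ← tupleCount_and_not]
    refine tupleCount_congr fun f => ⟨fun h => ⟨h.2, h.1.1⟩, ?_⟩
    rintro ⟨h, h'⟩
    rw [IntersectingTriple, ← h]
    exact ⟨⟨h', self _ _ h', fun h => h' h.symm⟩, rfl⟩
  have c3 : tupleCount (fun f : Fin 3 → Finset (Fin n) => IntersectingTriple f ∧ f 1 = f 2) =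
      4 ^ n - 3 ^ n := by
    rw [← e3, ← d3, ← tupleCount_and_not]
    refine tupleCount_congr fun f => ⟨fun h => ⟨h.2, h.1.1⟩, ?_⟩
    rintro ⟨h, h'⟩
    rw [IntersectingTriple, ← h]
    exact ⟨⟨h', h', self _ (f 0) fun h => h' h.symm⟩, rfl⟩
  have c4 : tupleCount (fun f : Fin 3 → Finset (Fin n) =>
      IntersectingTriple f ∧ f 0 = f 1 ∧ f 0 = f 2) = 2 ^ n - 1 ^ n := by
    rw [← e4, ← d4, ← tupleCount_and_not]
    refine tupleCount_congr fun f => ⟨fun h => ⟨h.2, h.1.1⟩, ?_⟩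
    rintro ⟨⟨h1, h2⟩, h'⟩
    rw [IntersectingTriple, ← h2, ← h1]
    rw [← h1] at h'
    exact ⟨⟨h', h', h'⟩, rfl, rfl⟩
  have key := tupleCount_and_not_and_not_and_not (IntersectingTriple (n := n))
    (fun f => f 0 = f 1) (fun f => f 0 = f 2) (fun f => f 1 = f 2)
  rw [tupleCount_congr (Q := fun f => IntersectingTriple f ∧ f 0 = f 1 ∧ f 1 = f 2)
      (Q' := fun f => IntersectingTriple f ∧ f 0 = f 1 ∧ f 0 = f 2) (fun f => by grind),
    tupleCount_congr (Q := fun f => IntersectingTriple f ∧ f 0 = f 2 ∧ f 1 = f 2)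
      (Q' := fun f => IntersectingTriple f ∧ f 0 = f 1 ∧ f 0 = f 2) (fun f => by grind),
    tupleCount_congr (Q := fun f => IntersectingTriple f ∧ f 0 = f 1 ∧ f 0 = f 2 ∧ f 1 = f 2)
      (Q' := fun f => IntersectingTriple f ∧ f 0 = f 1 ∧ f 0 = f 2) (fun f => by grind),
    tupleCount_intersectingTriple, c1, c2, c3, c4] at key
  refine key.trans ?_
  ring

theorem coverTwice_iff_columns {a b c : Finset (Fin n)} : CoverTwice a b c ↔
    ∀ i, (!(decide (i ∈ a) && (decide (i ∈ b) && decide (i ∈ c))) &&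
      ((!decide (i ∈ a) || (decide (i ∈ b) || decide (i ∈ c))) &&
      ((!decide (i ∈ b) || (decide (i ∈ a) || decide (i ∈ c))) &&
      (!decide (i ∈ c) || (decide (i ∈ a) || decide (i ∈ b)))))) = true := by
  simp [CoverTwice, imp_iff_not_or]

theorem tupleCount_coverTwice :
    tupleCount (fun f : Fin 3 → Finset (Fin n) => CoverTwice (f 0) (f 1) (f 2) ∧
      IntersectingTriple f) = 4 ^ n - 3 * 3 ^ n + 3 * 2 ^ n - 1 := by
  set P : (Fin 3 → Bool) → Bool := fun v => !(v 0 && (v 1 && v 2)) && ((!v 0 || (v 1 || v 2)) &&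
    ((!v 1 || (v 0 || v 2)) && (!v 2 || (v 0 || v 1)))) with hP
  have h0 : tupleCount (fun f : Fin 3 → Finset (Fin n) => CoverTwice (f 0) (f 1) (f 2)) = _ :=
    tupleCount_of_columns 4 P (fun f => coverTwice_iff_columns) (by decide)
  have h1 : tupleCount (fun f : Fin 3 → Finset (Fin n) =>
      CoverTwice (f 0) (f 1) (f 2) ∧ Disjoint (f 0) (f 1)) = _ :=
    tupleCount_of_columns 3 (fun v => P v && !(v 0 && v 1))
      (by simp [coverTwice_iff_columns, hP, disjoint_iff_forall, forall_and]) (by decide)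
  have h2 : tupleCount (fun f : Fin 3 → Finset (Fin n) =>
      CoverTwice (f 0) (f 1) (f 2) ∧ Disjoint (f 0) (f 2)) = _ :=
    tupleCount_of_columns 3 (fun v => P v && !(v 0 && v 2))
      (by simp [coverTwice_iff_columns, hP, disjoint_iff_forall, forall_and]) (by decide)
  have h3 : tupleCount (fun f : Fin 3 → Finset (Fin n) =>
      CoverTwice (f 0) (f 1) (f 2) ∧ Disjoint (f 1) (f 2)) = _ :=
    tupleCount_of_columns 3 (fun v => P v && !(v 1 && v 2))
      (by simp [coverTwice_iff_columns, hP, disjoint_iff_forall, forall_and]) (by decide)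
  have h12 : tupleCount (fun f : Fin 3 → Finset (Fin n) => CoverTwice (f 0) (f 1) (f 2) ∧
      Disjoint (f 0) (f 1) ∧ Disjoint (f 0) (f 2)) = _ :=
    tupleCount_of_columns 2 (fun v => P v && (!(v 0 && v 1) && !(v 0 && v 2)))
      (by simp [coverTwice_iff_columns, hP, disjoint_iff_forall, forall_and]) (by decide)
  have h13 : tupleCount (fun f : Fin 3 → Finset (Fin n) => CoverTwice (f 0) (f 1) (f 2) ∧
      Disjoint (f 0) (f 1) ∧ Disjoint (f 1) (f 2)) = _ :=
    tupleCount_of_columns 2 (fun v => P v && (!(v 0 && v 1) && !(v 1 && v 2)))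
      (by simp [coverTwice_iff_columns, hP, disjoint_iff_forall, forall_and]) (by decide)
  have h23 : tupleCount (fun f : Fin 3 → Finset (Fin n) => CoverTwice (f 0) (f 1) (f 2) ∧
      Disjoint (f 0) (f 2) ∧ Disjoint (f 1) (f 2)) = _ :=
    tupleCount_of_columns 2 (fun v => P v && (!(v 0 && v 2) && !(v 1 && v 2)))
      (by simp [coverTwice_iff_columns, hP, disjoint_iff_forall, forall_and]) (by decide)
  have h123 : tupleCount (fun f : Fin 3 → Finset (Fin n) => CoverTwice (f 0) (f 1) (f 2) ∧
      Disjoint (f 0) (f 1) ∧ Disjoint (f 0) (f 2) ∧ Disjoint (f 1) (f 2)) = _ :=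
    tupleCount_of_columns 1 (fun v => P v && (!(v 0 && v 1) && (!(v 0 && v 2) && !(v 1 && v 2))))
      (by simp [coverTwice_iff_columns, hP, disjoint_iff_forall, forall_and]) (by decide)
  have key := tupleCount_and_not_and_not_and_not
    (fun f : Fin 3 → Finset (Fin n) => CoverTwice (f 0) (f 1) (f 2))
    (fun f => Disjoint (f 0) (f 1)) (fun f => Disjoint (f 0) (f 2)) (fun f => Disjoint (f 1) (f 2))
  rw [h0, h1, h2, h3, h12, h13, h23, h123] at key
  refine key.trans ?_
  ring

end Triples

/-! ### Quadruples with `1_a + 1_b = 1_c + 1_e` -/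

section Quadruples

theorem tupleCount_comp_perm {k : ℕ} (σ : Equiv.Perm (Fin k))
    (Q : (Fin k → Finset (Fin n)) → Prop) :
    tupleCount (fun f => Q (f ∘ σ)) = tupleCount Q := by
  classical
  exact Equiv.sum_comp (σ.symm.arrowCongr (Equiv.refl (Finset (Fin n))))
    (fun f => if Q f then (1 : ℤ) else 0)

variable {a b c e e' : Finset (Fin n)}

theorem PairSumEq.symm (h : PairSumEq a b c e) : PairSumEq c e a b := ⟨h.1.symm, h.2.symm⟩

theorem PairSumEq.swap_left (h : PairSumEq a b c e) : PairSumEq b a c e := by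
  rwa [PairSumEq, Finset.inter_comm, Finset.union_comm]

theorem PairSumEq.swap_right (h : PairSumEq a b c e) : PairSumEq a b e c :=
  h.symm.swap_left.symm

theorem eq_of_ind_eq (h : ∀ i, ind a i = ind b i) : a = b := by
  ext i
  have := h i
  by_cases ha : i ∈ a <;> by_cases hb : i ∈ b <;> simp [ind, ha, hb] at this ⊢

theorem PairSumEq.right_unique (h : PairSumEq a b c e) (h' : PairSumEq a b c e') : e = e' := by
  rw [pairSumEq_iff_ind] at h h'
  exact eq_of_ind_eq fun i => by linarith [h i, h' i]

theorem pairSumEq_self (a b : Finset (Fin n)) : PairSumEq a b a b := ⟨rfl, rfl⟩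

theorem PairSumEq.right_eq (h : PairSumEq a b a e) : b = e := (pairSumEq_self a b).right_unique h

theorem PairSumEq.eq_of_left_eq (h : PairSumEq a a c e) : a = c := by
  obtain ⟨h1, h2⟩ := h
  rw [Finset.inter_self] at h1
  rw [Finset.union_self] at h2
  exact Finset.Subset.antisymm (h1 ▸ Finset.inter_subset_left) (h2 ▸ Finset.subset_union_left)

/-- A set cannot stand on the side of the new set in two completions: the new sets would have the
average `1_a`, so both would be `a`. -/
theorem PairSumEq.eq_of_pairSumEq (h : PairSumEq a b c e) (h' : PairSumEq a c b e') : e = a := by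
  rw [pairSumEq_iff_ind] at h h'
  refine eq_of_ind_eq fun i => ?_
  have h1 := h i
  have h2 := h' i
  rcases ind_eq_zero_or_one a i with h3 | h3 <;> rcases ind_eq_zero_or_one e i with h4 | h4 <;>
    rcases ind_eq_zero_or_one e' i with h5 | h5 <;> linarith

/-- Four distinct sets with `1_{q 0} + 1_{q 1} = 1_{q 2} + 1_{q 3}` that have a common point. -/
def IsQuad (q : Fin 4 → Finset (Fin n)) : Prop :=
  PairSumEq (q 0) (q 1) (q 2) (q 3) ∧ ¬ Disjoint (q 0) (q 1) ∧ Function.Injective q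

theorem injective_fin_three_iff {ι : Type*} {f : Fin 3 → ι} :
    Function.Injective f ↔ f 0 ≠ f 1 ∧ f 0 ≠ f 2 ∧ f 1 ≠ f 2 := by
  refine ⟨fun h => ⟨h.ne (by decide), h.ne (by decide), h.ne (by decide)⟩, ?_⟩
  rintro ⟨h1, h2, h3⟩ i j h
  fin_cases i <;> fin_cases j <;> simp_all

theorem injective_fin_four_iff {ι : Type*} {f : Fin 4 → ι} :
    Function.Injective f ↔ (f 0 ≠ f 1 ∧ f 0 ≠ f 2 ∧ f 1 ≠ f 2) ∧ f 0 ≠ f 3 ∧ f 1 ≠ f 3 ∧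
      f 2 ≠ f 3 := by
  refine ⟨fun h => ⟨⟨h.ne (by decide), h.ne (by decide), h.ne (by decide)⟩, h.ne (by decide),
    h.ne (by decide), h.ne (by decide)⟩, ?_⟩
  rintro ⟨⟨h1, h2, h3⟩, h4, h5, h6⟩ i j h
  fin_cases i <;> fin_cases j <;> simp_all

theorem PairSumEq.injective_iff {q : Fin 4 → Finset (Fin n)}
    (h : PairSumEq (q 0) (q 1) (q 2) (q 3)) :
    Function.Injective q ↔ q 0 ≠ q 2 ∧ q 0 ≠ q 3 := by
  rw [injective_fin_four_iff]
  refine ⟨fun h => ⟨h.1.2.1, h.2.1⟩, fun ⟨h1, h2⟩ => ⟨⟨fun h' => h1 ?_, h1, fun h' => h2 ?_⟩, h2,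
    fun h' => h1 ?_, fun h' => h1 ?_⟩⟩
  · rw [← h'] at h
    exact h.eq_of_left_eq
  · rw [h'] at h
    exact h.swap_left.right_eq
  · rw [h'] at h
    exact h.swap_left.swap_right.right_eq
  · rw [← h'] at h
    exact h.symm.eq_of_left_eq.symm

theorem pairSumEq_iff_columns : PairSumEq a b c e ↔
    ∀ i, ((decide (i ∈ a) && decide (i ∈ b)) == (decide (i ∈ c) && decide (i ∈ e)) &&
      (decide (i ∈ a) || decide (i ∈ b)) == (decide (i ∈ c) || decide (i ∈ e))) = true := by
  simp only [PairSumEq, Finset.ext_iff, ← forall_and, Finset.mem_inter, Finset.mem_union]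
  refine forall_congr' fun i => ?_
  by_cases ha : i ∈ a <;> by_cases hb : i ∈ b <;> by_cases hc : i ∈ c <;> by_cases he : i ∈ e <;>
    simp [ha, hb, hc, he]

theorem tupleCount_isQuad :
    tupleCount (IsQuad (n := n)) =
      6 ^ n - 5 ^ n - 2 * (4 ^ n - 3 ^ n) + (2 ^ n - 1) := by
  set P : (Fin 4 → Bool) → Bool := fun v =>
    (v 0 && v 1) == (v 2 && v 3) && (v 0 || v 1) == (v 2 || v 3) with hP
  have hcol : ∀ (f : Fin 4 → Finset (Fin n)), PairSumEq (f 0) (f 1) (f 2) (f 3) ↔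
      ∀ i, P (fun j => decide (i ∈ f j)) = true := fun f => pairSumEq_iff_columns
  have h0 : tupleCount (fun f : Fin 4 → Finset (Fin n) =>
      PairSumEq (f 0) (f 1) (f 2) (f 3)) = _ :=
    tupleCount_of_columns 6 P hcol (by decide)
  have d0 : tupleCount (fun f : Fin 4 → Finset (Fin n) =>
      PairSumEq (f 0) (f 1) (f 2) (f 3) ∧ Disjoint (f 0) (f 1)) = _ :=
    tupleCount_of_columns 5 (fun v => P v && !(v 0 && v 1))
      (by simp [hcol, disjoint_iff_forall, forall_and]) (by decide)
  have h1 : tupleCount (fun f : Fin 4 → Finset (Fin n) =>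
      PairSumEq (f 0) (f 1) (f 2) (f 3) ∧ f 0 = f 2) = _ :=
    tupleCount_of_columns 4 (fun v => P v && v 0 == v 2)
      (by simp [hcol, Finset.ext_iff, forall_and]) (by decide)
  have d1 : tupleCount (fun f : Fin 4 → Finset (Fin n) =>
      (PairSumEq (f 0) (f 1) (f 2) (f 3) ∧ f 0 = f 2) ∧ Disjoint (f 0) (f 1)) = _ :=
    tupleCount_of_columns 3 (fun v => P v && v 0 == v 2 && !(v 0 && v 1))
      (by simp [hcol, Finset.ext_iff, disjoint_iff_forall, forall_and]) (by decide)
  have h2 : tupleCount (fun f : Fin 4 → Finset (Fin n) =>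
      PairSumEq (f 0) (f 1) (f 2) (f 3) ∧ f 0 = f 3) = _ :=
    tupleCount_of_columns 4 (fun v => P v && v 0 == v 3)
      (by simp [hcol, Finset.ext_iff, forall_and]) (by decide)
  have d2 : tupleCount (fun f : Fin 4 → Finset (Fin n) =>
      (PairSumEq (f 0) (f 1) (f 2) (f 3) ∧ f 0 = f 3) ∧ Disjoint (f 0) (f 1)) = _ :=
    tupleCount_of_columns 3 (fun v => P v && v 0 == v 3 && !(v 0 && v 1))
      (by simp [hcol, Finset.ext_iff, disjoint_iff_forall, forall_and]) (by decide)
  have h3 : tupleCount (fun f : Fin 4 → Finset (Fin n) =>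
      PairSumEq (f 0) (f 1) (f 2) (f 3) ∧ f 0 = f 2 ∧ f 0 = f 3) = _ :=
    tupleCount_of_columns 2 (fun v => P v && (v 0 == v 2 && v 0 == v 3))
      (by simp [hcol, Finset.ext_iff, forall_and]) (by decide)
  have d3 : tupleCount (fun f : Fin 4 → Finset (Fin n) =>
      (PairSumEq (f 0) (f 1) (f 2) (f 3) ∧ f 0 = f 2 ∧ f 0 = f 3) ∧ Disjoint (f 0) (f 1)) = _ :=
    tupleCount_of_columns 1 (fun v => P v && (v 0 == v 2 && v 0 == v 3) && !(v 0 && v 1))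
      (by simp [hcol, Finset.ext_iff, disjoint_iff_forall, forall_and]) (by decide)
  have key := tupleCount_and_not_and_not
    (fun f : Fin 4 → Finset (Fin n) => PairSumEq (f 0) (f 1) (f 2) (f 3) ∧ ¬ Disjoint (f 0) (f 1))
    (fun f => f 0 = f 2) (fun f => f 0 = f 3)
  simp only [and_right_comm (b := ¬ Disjoint _ _)] at key
  rw [tupleCount_congr (Q := IsQuad) (Q' := fun f => (PairSumEq (f 0) (f 1) (f 2) (f 3) ∧
    ¬ f 0 = f 2 ∧ ¬ f 0 = f 3) ∧ ¬ Disjoint (f 0) (f 1)), key, tupleCount_and_not,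
    tupleCount_and_not, tupleCount_and_not, tupleCount_and_not, h0, h1, h2, h3, d0, d1, d2, d3]
  · ring
  · intro f
    rw [IsQuad, and_right_comm (b := ¬ f 0 = f 2 ∧ ¬ f 0 = f 3), and_assoc]
    exact and_congr_right fun h => and_congr_right fun _ => h.injective_iff

/-- A quadruple whose first member in the order is `q m`. -/
def IsQuadWithFirst (m : Fin 4) (q : Fin 4 → Finset (Fin n)) : Prop :=
  IsQuad q ∧ ∀ j, j ≠ m → toColex (q j) < toColex (q m)

theorem PairSumEq.exists_common_mem (h : PairSumEq a b c e) (hd : ¬ Disjoint a b) :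
    ∃ p, p ∈ a ∧ p ∈ b ∧ p ∈ c ∧ p ∈ e := by
  obtain ⟨p, hpa, hpb⟩ := Finset.not_disjoint_iff.mp hd
  have : p ∈ c ∩ e := h.1 ▸ Finset.mem_inter.mpr ⟨hpa, hpb⟩
  exact ⟨p, hpa, hpb, Finset.mem_inter.mp this⟩

theorem IsQuad.comp_swap_right {q : Fin 4 → Finset (Fin n)} (h : IsQuad q) :
    IsQuad (q ∘ Equiv.swap 2 3) :=
  ⟨h.1.swap_right, h.2.1, h.2.2.comp (Equiv.injective _)⟩

theorem IsQuad.comp_swap_sides {q : Fin 4 → Finset (Fin n)} (h : IsQuad q) :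
    IsQuad (q ∘ (Equiv.swap 0 2 * Equiv.swap 1 3 : Equiv.Perm (Fin 4))) := by
  obtain ⟨p, h0, h1, h2, h3⟩ := h.1.exists_common_mem h.2.1
  exact ⟨h.1.symm, Finset.not_disjoint_iff.mpr ⟨p, h2, h3⟩, h.2.2.comp (Equiv.injective _)⟩

/-- A symmetry of the relation between the four sets, of order two, moves the first member. -/
theorem tupleCount_isQuadWithFirst_perm (σ : Equiv.Perm (Fin 4)) (hσ : σ * σ = 1)
    (h : ∀ q : Fin 4 → Finset (Fin n), IsQuad q → IsQuad (q ∘ σ)) (m : Fin 4) :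
    tupleCount (IsQuadWithFirst (n := n) (σ m)) = tupleCount (IsQuadWithFirst (n := n) m) := by
  have hσσ : ∀ j, σ (σ j) = j := fun j => by rw [← Equiv.Perm.mul_apply, hσ]; rfl
  rw [← tupleCount_comp_perm σ (IsQuadWithFirst (n := n) m)]
  refine tupleCount_congr fun q => and_congr ⟨h q, fun hq => ?_⟩ ?_
  · have := h _ hq
    rwa [Function.comp_assoc, show ⇑σ ∘ ⇑σ = id from funext hσσ, Function.comp_id] at this
  · refine ⟨fun hq j hj => hq (σ j) fun h => hj (σ.injective h), fun hq j hj => ?_⟩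
    have := hq (σ j) fun h => hj (by rw [← h, hσσ])
    simpa only [Function.comp_apply, hσσ] using this

/-- By symmetry, each of the four members comes first equally often. -/
theorem tupleCount_isQuad_eq_four_mul :
    tupleCount (IsQuad (n := n)) = 4 * tupleCount (IsQuadWithFirst (n := n) 3) := by
  have h2 := tupleCount_isQuadWithFirst_perm (n := n) (Equiv.swap 2 3) (by decide)
    (fun q h => h.comp_swap_right) 3
  have h1 := tupleCount_isQuadWithFirst_perm (n := n) (Equiv.swap 0 2 * Equiv.swap 1 3)
    (by decide) (fun q h => h.comp_swap_sides) 3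
  have h0 := tupleCount_isQuadWithFirst_perm (n := n) (Equiv.swap 0 2 * Equiv.swap 1 3)
    (by decide) (fun q h => h.comp_swap_sides) 2
  rw [show Equiv.swap (2 : Fin 4) 3 3 = 2 by decide] at h2
  rw [show (Equiv.swap 0 2 * Equiv.swap 1 3 : Equiv.Perm (Fin 4)) 3 = 1 by decide] at h1
  rw [show (Equiv.swap 0 2 * Equiv.swap 1 3 : Equiv.Perm (Fin 4)) 2 = 0 by decide] at h0
  have key : tupleCount (IsQuad (n := n)) = ∑ m, tupleCount (IsQuadWithFirst (n := n) m) := by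
    classical
    simp only [tupleCount]
    rw [Finset.sum_comm]
    refine Finset.sum_congr rfl fun q _ => ?_
    by_cases hq : IsQuad q
    · obtain ⟨m, -, hm⟩ := Finset.univ.exists_max_image (fun j => toColex (q j))
        Finset.univ_nonempty
      have hlt : ∀ j, j ≠ m → toColex (q j) < toColex (q m) := fun j hj =>
        lt_of_le_of_ne (hm j (Finset.mem_univ j)) fun h => hj (hq.2.2 (toColex.injective h))
      rw [if_pos hq, Finset.sum_eq_single m, if_pos ⟨hq, hlt⟩]
      · intro j _ hj
        exact if_neg fun h => lt_asymm (h.2 m hj.symm) (hlt j hj)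
      · simp
    · rw [if_neg hq]
      exact (Finset.sum_eq_zero fun m _ => if_neg fun h => hq h.1).symm
  rw [key, Fin.sum_univ_four, h0, h1, h2]
  ring

/-- The completing set is determined by the triple, so these triples are quadruples with their
first member removed. -/
theorem tupleCount_hasEarlierPartner :
    tupleCount (fun f : Fin 3 → Finset (Fin n) => DistinctIntersectingTriple f ∧
      HasEarlierPartner (f 0) (f 1) (f 2)) = tupleCount (IsQuadWithFirst (n := n) 3) := by
  classical
  rw [tupleCount_eq_card, tupleCount_eq_card, Nat.cast_inj]
  symm
  refine Finset.card_bij (fun q _ => ![q 0, q 1, q 2]) ?_ ?_ ?_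
  · intro q hq
    simp only [Finset.mem_filter, Finset.mem_univ, true_and] at hq ⊢
    obtain ⟨⟨hrel, hd, hinj⟩, hlt⟩ := hq
    obtain ⟨p, h0, h1, h2, h3⟩ := hrel.exists_common_mem hd
    refine ⟨⟨⟨hd, ?_, ?_⟩, (injective_fin_four_iff.mp hinj).1⟩, q 3,
      ⟨hlt 0 (by decide), hlt 1 (by decide), hlt 2 (by decide)⟩, hrel⟩
    · exact Finset.not_disjoint_iff.mpr ⟨p, h0, h2⟩
    · exact Finset.not_disjoint_iff.mpr ⟨p, h1, h2⟩
  · intro q hq q' hq' h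
    simp only [Finset.mem_filter, Finset.mem_univ, true_and] at hq hq'
    have hrel := hq.1.1
    have hrel' := hq'.1.1
    have e0 : q 0 = q' 0 := congrFun h 0
    have e1 : q 1 = q' 1 := congrFun h 1
    have e2 : q 2 = q' 2 := congrFun h 2
    rw [← e0, ← e1, ← e2] at hrel'
    have e3 := hrel.right_unique hrel'
    ext1 j
    fin_cases j
    exacts [e0, e1, e2, e3]
  · intro f hf
    simp only [Finset.mem_filter, Finset.mem_univ, true_and] at hf ⊢
    obtain ⟨⟨⟨hd, -, -⟩, hne⟩, e, ⟨h0, h1, h2⟩, hrel⟩ := hf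
    refine ⟨![f 0, f 1, f 2, e],
      ⟨⟨hrel, hd, injective_fin_four_iff.mpr ⟨hne, ?_⟩⟩, ?_⟩, ?_⟩
    · exact ⟨fun h => h0.ne (congrArg toColex h), fun h => h1.ne (congrArg toColex h),
        fun h => h2.ne (congrArg toColex h)⟩
    · intro j hj
      fin_cases j
      exacts [h0, h1, h2, absurd rfl hj]
    · ext1 j
      fin_cases j <;> rfl

end Quadruples

/-! ### Counting sets without broken circuits -/

section Betti

open Classical in
/-- The sets of `k` nonempty subsets of `Fin n` without broken circuits. -/
def nbcSets (n k : ℕ) : Finset (Finset (Finset (Fin n))) :=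
  ((nonemptySets n).powersetCard k).filter (IsNBC sumOn toColex (nonemptySets n))

theorem mem_nbcSets {k : ℕ} {S : Finset (Finset (Fin n))} : S ∈ nbcSets n k ↔
    (S ⊆ nonemptySets n ∧ S.card = k) ∧ IsNBC sumOn toColex (nonemptySets n) S := by
  simp only [nbcSets, Finset.mem_filter, Finset.mem_powersetCard]

theorem two_mul_card_nbcSets_two (n : ℕ) :
    2 * ((nbcSets n 2).card : ℤ) = 4 ^ n - 3 ^ n - 2 ^ n + 1 := by
  have h := factorial_mul_card_eq_tupleCount (nbcSets n 2) fun S h => (mem_nbcSets.mp h).1.2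
  rw [Nat.factorial_two, Nat.cast_ofNat] at h
  rw [h, ← tupleCount_intersecting_pairs]
  refine tupleCount_congr fun f => ?_
  have himg : Finset.univ.image f = {f 0, f 1} := by
    ext s
    simp [Fin.exists_fin_two, eq_comm]
  rw [himg]
  rw [mem_nbcSets]
  constructor
  · rintro ⟨⟨hsub, hcard⟩, h⟩
    have hne : f 0 ≠ f 1 := fun h0 => by simp [h0] at hcard
    exact ⟨(isNBC_pair_iff (mem_nonemptySets.mp (hsub (by simp)))
      (mem_nonemptySets.mp (hsub (by simp))) hne).mp h, hne⟩
  · rintro ⟨hd, hne⟩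
    obtain ⟨p, h0, h1⟩ := Finset.not_disjoint_iff.mp hd
    refine ⟨⟨?_, Finset.card_pair hne⟩, (isNBC_pair_iff ⟨p, h0⟩ ⟨p, h1⟩ hne).mpr hd⟩
    simp only [Finset.insert_subset_iff, Finset.singleton_subset_iff, mem_nonemptySets]
    exact ⟨⟨p, h0⟩, ⟨p, h1⟩⟩

theorem image_mem_nbcSets_three_iff (f : Fin 3 → Finset (Fin n)) :
    Finset.univ.image f ∈ nbcSets n 3 ↔ DistinctIntersectingTriple f ∧
      ¬ CoverTwice (f 0) (f 1) (f 2) ∧ ¬ HasEarlierPartner (f 0) (f 1) (f 2) ∧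
      ¬ HasEarlierPartner (f 0) (f 2) (f 1) ∧ ¬ HasEarlierPartner (f 1) (f 2) (f 0) := by
  have himg : Finset.univ.image f = {f 0, f 1, f 2} := by
    ext s
    simp [Fin.exists_fin_succ, eq_comm]
  rw [mem_nbcSets]
  constructor
  · rintro ⟨⟨hsub, hcard⟩, h⟩
    have hne : Function.Injective f := by
      rw [← Set.injOn_univ, ← Finset.coe_univ, ← Finset.card_image_iff, hcard]
      simp
    rw [injective_fin_three_iff] at hne
    have hmem : ∀ j, (f j).Nonempty := fun j => mem_nonemptySets.mp (hsub (by simp))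
    rw [himg, isNBC_triple_iff (hmem 0) (hmem 1) (hmem 2) hne.1 hne.2.1 hne.2.2] at h
    exact ⟨⟨h.1, hne⟩, h.2⟩
  · rintro ⟨⟨⟨h1, h2, h3⟩, hne⟩, h⟩
    obtain ⟨p, hp0, hp1⟩ := Finset.not_disjoint_iff.mp h1
    obtain ⟨q, -, hq⟩ := Finset.not_disjoint_iff.mp h2
    refine ⟨⟨?_, ?_⟩, ?_⟩
    · rw [himg]
      simp only [Finset.insert_subset_iff, Finset.singleton_subset_iff, mem_nonemptySets]
      exact ⟨⟨p, hp0⟩, ⟨p, hp1⟩, ⟨q, hq⟩⟩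
    · rw [Finset.card_image_of_injective _ (injective_fin_three_iff.mpr hne)]
      simp
    · rw [himg, isNBC_triple_iff ⟨p, hp0⟩ ⟨p, hp1⟩ ⟨q, hq⟩ hne.1 hne.2.1 hne.2.2]
      exact ⟨⟨h1, h2, h3⟩, h⟩

theorem HasEarlierPartner.symm {a b c : Finset (Fin n)} (h : HasEarlierPartner a b c) :
    HasEarlierPartner b a c := by
  obtain ⟨e, ⟨ha, hb, hc⟩, hr⟩ := h
  exact ⟨e, ⟨hb, ha, hc⟩, hr.swap_left⟩

theorem HasEarlierPartner.not_hasEarlierPartner {a b c : Finset (Fin n)}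
    (h : HasEarlierPartner a b c) : ¬ HasEarlierPartner a c b := by
  rintro ⟨e', -, hr'⟩
  obtain ⟨e, ⟨ha, -, -⟩, hr⟩ := h
  exact ha.ne (congrArg toColex (hr.eq_of_pairSumEq hr').symm)

theorem CoverTwice.not_hasEarlierPartner {a b c : Finset (Fin n)} (h : CoverTwice a b c)
    (hd : ¬ Disjoint a b) : ¬ HasEarlierPartner a b c := by
  rintro ⟨e, -, hr⟩
  obtain ⟨p, ha, hb, hc, -⟩ := hr.exists_common_mem hd
  exact (h p).1 ⟨ha, hb, hc⟩

theorem CoverTwice.swap_right {a b c : Finset (Fin n)} (h : CoverTwice a b c) :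
    CoverTwice a c b := fun i => by
  have := h i
  tauto

theorem CoverTwice.rotate {a b c : Finset (Fin n)} (h : CoverTwice a b c) :
    CoverTwice b c a := fun i => by
  have := h i
  tauto

theorem CoverTwice.distinctIntersectingTriple {f : Fin 3 → Finset (Fin n)}
    (h : CoverTwice (f 0) (f 1) (f 2)) (hI : IntersectingTriple f) :
    DistinctIntersectingTriple f := by
  obtain ⟨p, p0, p1⟩ := Finset.not_disjoint_iff.mp hI.1
  obtain ⟨q, q0, q2⟩ := Finset.not_disjoint_iff.mp hI.2.1
  refine ⟨hI, fun he => ?_, fun he => ?_, fun he => ?_⟩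
  · exact (h q).1 ⟨q0, he ▸ q0, q2⟩
  · exact (h p).1 ⟨p0, p1, he ▸ p0⟩
  · exact (h p).1 ⟨p0, p1, he ▸ p1⟩

/-- The factor `3` is the choice of the member that stands on the side of the completing set. -/
theorem tupleCount_image_mem_nbcSets_three (n : ℕ) :
    tupleCount (fun f : Fin 3 → Finset (Fin n) => Finset.univ.image f ∈ nbcSets n 3) =
      tupleCount (DistinctIntersectingTriple (n := n)) -
        tupleCount (fun f : Fin 3 → Finset (Fin n) => CoverTwice (f 0) (f 1) (f 2) ∧
          IntersectingTriple f) -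
        3 * tupleCount (IsQuadWithFirst (n := n) 3) := by
  have h1 := tupleCount_hasEarlierPartner (n := n)
  have h2 : tupleCount (fun f : Fin 3 → Finset (Fin n) => DistinctIntersectingTriple f ∧
      HasEarlierPartner (f 0) (f 2) (f 1)) = tupleCount (IsQuadWithFirst (n := n) 3) := by
    rw [← h1, ← tupleCount_comp_perm (Equiv.swap 1 2)]
    refine tupleCount_congr fun f => and_congr_left fun _ => ?_
    have e0 : Equiv.swap (1 : Fin 3) 2 0 = 0 := by decide
    have e1 : Equiv.swap (1 : Fin 3) 2 1 = 2 := by decide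
    have e2 : Equiv.swap (1 : Fin 3) 2 2 = 1 := by decide
    simp only [DistinctIntersectingTriple, IntersectingTriple, Function.comp_apply, e0, e1, e2,
      disjoint_comm (a := f 2) (b := f 1), ne_comm (a := f 2) (b := f 1)]
    tauto
  have h3 : tupleCount (fun f : Fin 3 → Finset (Fin n) => DistinctIntersectingTriple f ∧
      HasEarlierPartner (f 1) (f 2) (f 0)) = tupleCount (IsQuadWithFirst (n := n) 3) := by
    rw [← h2, ← tupleCount_comp_perm (Equiv.swap 0 1)]
    have e0 : Equiv.swap (0 : Fin 3) 1 0 = 1 := by decide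
    have e1 : Equiv.swap (0 : Fin 3) 1 1 = 0 := by decide
    have e2 : Equiv.swap (0 : Fin 3) 1 2 = 2 := by decide
    refine tupleCount_congr fun f => and_congr ?_ (by simp only [Function.comp_apply, e0, e1, e2])
    simp only [DistinctIntersectingTriple, IntersectingTriple, Function.comp_apply, e0, e1, e2,
      disjoint_comm (a := f 1) (b := f 0), ne_comm (a := f 1) (b := f 0)]
    tauto
  have key : tupleCount (fun f : Fin 3 → Finset (Fin n) => Finset.univ.image f ∈ nbcSets n 3) =
      tupleCount (DistinctIntersectingTriple (n := n)) -
        tupleCount (fun f : Fin 3 → Finset (Fin n) => CoverTwice (f 0) (f 1) (f 2) ∧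
          IntersectingTriple f) -
        tupleCount (fun f : Fin 3 → Finset (Fin n) => DistinctIntersectingTriple f ∧
          HasEarlierPartner (f 0) (f 1) (f 2)) -
        tupleCount (fun f : Fin 3 → Finset (Fin n) => DistinctIntersectingTriple f ∧
          HasEarlierPartner (f 0) (f 2) (f 1)) -
        tupleCount (fun f : Fin 3 → Finset (Fin n) => DistinctIntersectingTriple f ∧
          HasEarlierPartner (f 1) (f 2) (f 0)) := by
    rw [tupleCount_congr image_mem_nbcSets_three_iff]
    simp only [tupleCount, ← Finset.sum_sub_distrib]
    refine Finset.sum_congr rfl fun f _ => ?_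
    -- The four ways to contain a broken circuit exclude each other.
    have x1 : HasEarlierPartner (f 0) (f 1) (f 2) → ¬ HasEarlierPartner (f 0) (f 2) (f 1) :=
      fun h => h.not_hasEarlierPartner
    have x2 : HasEarlierPartner (f 0) (f 1) (f 2) → ¬ HasEarlierPartner (f 1) (f 2) (f 0) :=
      fun h => h.symm.not_hasEarlierPartner
    have x3 : HasEarlierPartner (f 0) (f 2) (f 1) → ¬ HasEarlierPartner (f 1) (f 2) (f 0) :=
      fun h h' => h.symm.not_hasEarlierPartner h'.symm
    have y0 : CoverTwice (f 0) (f 1) (f 2) ∧ IntersectingTriple f →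
        DistinctIntersectingTriple f ∧ ¬ HasEarlierPartner (f 0) (f 1) (f 2) ∧
          ¬ HasEarlierPartner (f 0) (f 2) (f 1) ∧ ¬ HasEarlierPartner (f 1) (f 2) (f 0) := by
      rintro ⟨h, hI⟩
      exact ⟨h.distinctIntersectingTriple hI, h.not_hasEarlierPartner hI.1,
        h.swap_right.not_hasEarlierPartner hI.2.1, h.rotate.not_hasEarlierPartner hI.2.2⟩
    by_cases a0 : DistinctIntersectingTriple f
    · have hI := a0.1
      by_cases a1 : CoverTwice (f 0) (f 1) (f 2)
      · obtain ⟨-, b1, b2, b3⟩ := y0 ⟨a1, hI⟩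
        simp [a0, a1, hI, b1, b2, b3]
      · by_cases b1 : HasEarlierPartner (f 0) (f 1) (f 2)
        · simp [a0, a1, b1, x1 b1, x2 b1]
        · by_cases b2 : HasEarlierPartner (f 0) (f 2) (f 1)
          · simp [a0, a1, b1, b2, x3 b2]
          · by_cases b3 : HasEarlierPartner (f 1) (f 2) (f 0) <;> simp [a0, a1, b1, b2, b3]
    · have : ¬ (CoverTwice (f 0) (f 1) (f 2) ∧ IntersectingTriple f) := fun h => a0 (y0 h).1
      simp only [a0, this, false_and, if_false, sub_zero]
  rw [key, h1, h2, h3]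
  ring

theorem twentyFour_mul_card_nbcSets_three (n : ℕ) :
    24 * ((nbcSets n 3).card : ℤ) = 4 * 8 ^ n - 15 * 6 ^ n + 15 * 5 ^ n - 14 * 4 ^ n
      + 18 * 3 ^ n - 7 * 2 ^ n - 1 := by
  have h := factorial_mul_card_eq_tupleCount (nbcSets n 3) fun S h => (mem_nbcSets.mp h).1.2
  have h1 := tupleCount_isQuad (n := n)
  rw [tupleCount_isQuad_eq_four_mul] at h1
  have h2 := tupleCount_distinctIntersectingTriple (n := n)
  rw [tupleCount_image_mem_nbcSets_three, tupleCount_coverTwice] at h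
  rw [h2, show ((Nat.factorial 3 : ℕ) : ℤ) = 6 by decide] at h
  linarith

theorem betti_resonance_two (n : ℕ) (hn : 1 ≤ n) :
    (betti (resonance n) 2 : ℚ) = 1 / 2 * (4 ^ n - 3 ^ n - 2 ^ n + 1) := by
  rcases Nat.lt_or_ge n 2 with h | h
  · obtain rfl : n = 1 := by omega
    -- The Betti number vanishes by definition, as `2 > n`.
    simp [betti]
    norm_num
  · have h1 : ((2 * ((nbcSets n 2).card : ℤ) : ℤ) : ℚ) = _ :=
      congrArg _ (two_mul_card_nbcSets_two n)
    push_cast at h1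
    rw [betti_resonance h]
    change ((nbcSets n 2).card : ℚ) = _
    linarith

theorem betti_resonance_three (n : ℕ) (hn : 1 ≤ n) :
    (betti (resonance n) 3 : ℚ) = 1 / (Nat.factorial 4 : ℚ) * (4 * 8 ^ n - 15 * 6 ^ n + 15 * 5 ^ n
      - 14 * 4 ^ n + 18 * 3 ^ n - 7 * 2 ^ n - 1) := by
  rcases Nat.lt_or_ge n 3 with h | h
  · -- The Betti number vanishes by definition, as `3 > n`.
    rw [betti, if_neg (by omega)]
    interval_cases n <;> norm_num
  · have h1 : ((24 * ((nbcSets n 3).card : ℤ) : ℤ) : ℚ) = _ :=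
      congrArg _ (twentyFour_mul_card_nbcSets_three n)
    push_cast at h1
    rw [betti_resonance h, show (Nat.factorial 4 : ℚ) = 24 by norm_num [Nat.factorial]]
    change ((nbcSets n 3).card : ℚ) = _
    linarith

end Betti

/-! ### Stirling numbers -/

/-- The first argument is `n + 1`, as the closed forms fail for `S(0, k)`. -/
theorem stirlingSecond_closed_forms (n : ℕ) :
    (Nat.stirlingSecond (n + 1) 1 : ℚ) = 1 ∧
    (Nat.stirlingSecond (n + 1) 2 : ℚ) = 2 ^ n - 1 ∧
    (Nat.stirlingSecond (n + 1) 3 : ℚ) = (3 ^ n - 2 * 2 ^ n + 1) / 2 ∧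
    (Nat.stirlingSecond (n + 1) 4 : ℚ) = (4 ^ n - 3 * 3 ^ n + 3 * 2 ^ n - 1) / 6 ∧
    (Nat.stirlingSecond (n + 1) 5 : ℚ) =
      (5 ^ n - 4 * 4 ^ n + 6 * 3 ^ n - 4 * 2 ^ n + 1) / 24 ∧
    (Nat.stirlingSecond (n + 1) 6 : ℚ) =
      (6 ^ n - 5 * 5 ^ n + 10 * 4 ^ n - 10 * 3 ^ n + 5 * 2 ^ n - 1) / 120 ∧
    (Nat.stirlingSecond (n + 1) 7 : ℚ) =
      (7 ^ n - 6 * 6 ^ n + 15 * 5 ^ n - 20 * 4 ^ n + 15 * 3 ^ n - 6 * 2 ^ n + 1) / 720 ∧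
    (Nat.stirlingSecond (n + 1) 8 : ℚ) =
      (8 ^ n - 7 * 7 ^ n + 21 * 6 ^ n - 35 * 5 ^ n + 35 * 4 ^ n - 21 * 3 ^ n + 7 * 2 ^ n - 1)
        / 5040 := by
  induction n with
  | zero => norm_num [Nat.stirlingSecond]
  | succ n ih =>
    obtain ⟨h1, h2, h3, h4, h5, h6, h7, h8⟩ := ih
    have hrec (k : ℕ) : (Nat.stirlingSecond (n + 1 + 1) (k + 1) : ℚ) =
        (k + 1) * Nat.stirlingSecond (n + 1) (k + 1) + Nat.stirlingSecond (n + 1) k := by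
      rw [Nat.stirlingSecond_succ_succ]
      push_cast
      ring
    refine ⟨?_, ?_, ?_, ?_, ?_, ?_, ?_, ?_⟩
    · rw [hrec 0, h1]
      simp
    · rw [hrec 1, h1, h2]
      push_cast
      ring
    · rw [hrec 2, h2, h3]
      push_cast
      ring
    · rw [hrec 3, h3, h4]
      push_cast
      ring
    · rw [hrec 4, h4, h5]
      push_cast
      ring
    · rw [hrec 5, h5, h6]
      push_cast
      ring
    · rw [hrec 6, h6, h7]
      push_cast
      ring
    · rw [hrec 7, h7, h8]
      push_cast
      ring

end ResonanceArrangement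

end

theorem theorem1p3 (n : ℕ) (hn : 1 ≤ n) :
    (ResonanceArrangement.betti (ResonanceArrangement.resonance n) 2
        = 2 * Nat.stirlingSecond (n + 1) 3 + 3 * Nat.stirlingSecond (n + 1) 4 ∧
      (ResonanceArrangement.betti (ResonanceArrangement.resonance n) 2 : ℚ)
        = 1 / 2 * (4 ^ n - 3 ^ n - 2 ^ n + 1)) ∧
    (ResonanceArrangement.betti (ResonanceArrangement.resonance n) 3
        = 9 * Nat.stirlingSecond (n + 1) 4 + 80 * Nat.stirlingSecond (n + 1) 5
          + 345 * Nat.stirlingSecond (n + 1) 6 + 840 * Nat.stirlingSecond (n + 1) 7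
          + 840 * Nat.stirlingSecond (n + 1) 8 ∧
      (ResonanceArrangement.betti (ResonanceArrangement.resonance n) 3 : ℚ)
        = 1 / (Nat.factorial 4 : ℚ) * (4 * 8 ^ n - 15 * 6 ^ n + 15 * 5 ^ n - 14 * 4 ^ n
          + 18 * 3 ^ n - 7 * 2 ^ n - 1)) := by
  obtain ⟨-, -, h3, h4, h5, h6, h7, h8⟩ := ResonanceArrangement.stirlingSecond_closed_forms n
  have b2 := ResonanceArrangement.betti_resonance_two n hn
  have b3 := ResonanceArrangement.betti_resonance_three n hn
  refine ⟨⟨?_, b2⟩, ?_, b3⟩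
  · have : (ResonanceArrangement.betti (ResonanceArrangement.resonance n) 2 : ℚ) =
        2 * Nat.stirlingSecond (n + 1) 3 + 3 * Nat.stirlingSecond (n + 1) 4 := by
      rw [b2, h3, h4]
      ring
    exact_mod_cast this
  · have : (ResonanceArrangement.betti (ResonanceArrangement.resonance n) 3 : ℚ) =
        9 * Nat.stirlingSecond (n + 1) 4 + 80 * Nat.stirlingSecond (n + 1) 5
          + 345 * Nat.stirlingSecond (n + 1) 6 + 840 * Nat.stirlingSecond (n + 1) 7
          + 840 * Nat.stirlingSecond (n + 1) 8 := by
      rw [b3, h4, h5, h6, h7, h8, show (Nat.factorial 4 : ℚ) = 24 by norm_num [Nat.factorial]]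
      ring
    exact_mod_cast this
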